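/- **Setting.** Let $\mathcal H=\mathbb C^d$ with orthonormal basis $|1\rangle,\dots,|d\rangle$ and $\widetilde E_{(n,m)}=|n\rangle\langle m|$. Let $\mathcal E:\mathcal L(\mathcal H)\to\mathcal L(\mathcal H)$ be a quantum channel (from Alice to Bob) with an isometric extension $V:\mathcal H\to\mathcal H\otimes\mathcal H^E$, $\dim\mathcal H^E<\infty$, so that $\mathcal E(\rho)=\mathrm{tr}_E(V\rho V^\dagger)$; Eve receives $\mathcal E^\dagger(\rho)=\mathrm{tr}_B(V\rho V^\dagger)$. Let $\chi$ be the unique matrix with $\mathcal E(\rho)=\sum_{j,k}\chi_{j,k}\widetilde E_j\rho\widetilde E_k^\dagger$. Let $\rho_0$ (innocent) and $\rho_1$ be density operators on $\mathcal H$, $\rho_0^E=\mathcal E^\dagger(\rho_0)$. Let $D(\rho\|\sigma)=\mathrm{tr}\,\rho(\log\rho-\log\sigma)$ (natural logarithm) if $\mathrm{supp}\,\rho\subseteq\mathrm{supp}\,\sigma$, and $\infty$ otherwise, and $D^B=D(\mathcal E(\rho_1)\|\mathcal E(\rho_0))$, $D^E=D(\mathcal E^\dagger(\rho_1)\|\mathcal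 E^\dagger(\rho_0))$. Write $\lambda_{\min}$ for the smallest eigenvalue. **Protocol.** Let $q\ge1$, $\ell\geq 0$, $T'\ge q\ell$ be integers, $\tau>0$ and $\widetilde\lambda^\chi,\widetilde\lambda^B,\widetilde\lambda^E\in(0,1]$. Let $\mathcal S$ be the family of the $2d^2-d$ (labelled) pure states given by $|n\rangle$, by $|n,m,+\rangle=(|n\rangle+|m\rangle)/\sqrt2$ and by $|n,m,-\rangle=(|n\rangle+i|m\rangle)/\sqrt2$, over all $n$ and all ordered pairs $n\ne m$. Alice and Bob share private i.i.d. $U_1,\dots,U_\ell$, uniform on $\{1,\dots,q\}$. In $T'$ uses of $\mathcal E$, Alice sends $\rho_0$ except in the pulse positions $U_k+q(k-1)$, $k=1,\dots,\ell$, on which, in some fixed order known to both, she sends each state of $\mathcal S$ exactly $\lfloor\ell/|\mathcal S|\rfloor$ times, and $\rho_0$ on the left-over pulses. For all $\rho,\widetilde\rho\in\mathcal S$, Bob makes the measurement $\{\widetilde\rho,I-\widetilde\rho\}$ on $\widetilde\ell=\lfloor\lfloor\ell/|\mathcal S|\rfloor/|\mathcal S|\rfloor$ of the pulses that carry $\rho$;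 $\widehat f(\rho,\widetilde\rho)$ is the fraction of these with result $\widetilde\rho$. The public message $W$ is any function of Bob's results with values in $\{0,1\}^b$ ($b\ge0$ arbitrary), one-time padded with $b$ independent uniform private bits. $\rho^{\mathbf EW}$ is the joint state of Eve's $T'$ outputs and $W$; $\rho_0^{\mathbf E}=(\rho_0^E)^{\otimes T'}$, and $\rho^W_{\rm unif}$ is the maximally mixed state. **Estimators.** For $\rho\in\mathcal S$ let $\widehat{\mathcal E}(\rho)$ have entries $\langle n|\widehat{\mathcal E}(\rho)|n\rangle=\widehat f(\rho,|n\rangle)$ and, for $n\neq m$, $\langle n|\widehat{\mathcal E}(\rho)|m\rangle=\widehat f(\rho,|n,m,+\rangle)-i\widehat f(\rho,|n,m,-\rangle)-\frac{1-i}2\widehat f(\rho,|n\rangle)-\frac{1-i}2\widehat f(\rho,|m\rangle)$ (a pure state is denoted by its vector). Let $\widehat{\mathcal E}(\widetilde E_{(n,n)})=\widehat{\mathcal E}(|n\rangle)$ and, for $n\neq m$, $\widehat{\mathcal E}(\widetilde E_{(n,m)})=\widehat{\mathcal E}(|n,m,+\rangle)+i\widehat{\mathcal E}(|n,m,-\rangle)-\frac{1+i}2\widehat{\mathcal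 E}(|n\rangle)-\frac{1+i}2\widehat{\mathcal E}(|m\rangle)$. Let $\widehat\chi$ be the Hermitian part of the $\chi$-matrix of the linear map so defined, and for density operators $\rho$ put $\widehat{\mathcal E}(\rho)=\sum_{j,k}\widehat\chi_{j,k}\widetilde E_j\rho\widetilde E_k^\dagger$ and $\widehat{\mathcal E}^\dagger(\rho)=\overline{\sqrt{\widehat\chi}}\,\widetilde\rho\,\overline{\sqrt{\widehat\chi}}$, where $\widetilde\rho_{j,k}=\mathrm{tr}(\widetilde E_j\rho\widetilde E_k^\dagger)$, the bar is entrywise conjugation, and functions of Hermitian matrices are taken spectrally (with $\sqrt x:=0$ and $\log x:=\log|x|$ for $x<0$, $\log 0:=0$). Let $H=1$ if $\lambda_{\min}(\widehat\chi)\ge\widetilde\lambda^\chi-\tau$ and $\lambda_{\min}(\widehat{\mathcal E}(\rho_0))\ge\widetilde\lambda^B-\tau$, and $H=0$ (abort) otherwise. Let $\widehat D^B=D(\widehat{\mathcal E}(\rho_1)\|\widehat{\mathcal E}(\rho_0))-\tau$ and $\widehat D^E=D(\widehat{\mathcal E}^\dagger(\rho_1)\|\widehat{\mathcal E}^\dagger(\rho_0))+\tau$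 (with the real part of the trace in $D$). **Theorem.** There are $\xi>0$ and $\ell_0\in\mathbb N$ that depend only on $d,\tau,\widetilde\lambda^\chi,\widetilde\lambda^B,\widetilde\lambda^E$ such that, for all $\mathcal E$, $V$, $\rho_0$, $\rho_1$, $q$, $\ell$, $T'$ and all orders as above: 1. (covertness, for every $\ell$) if $\lambda_{\min}(\rho_0^E)\ge\widetilde\lambda^E$, then $$D(\rho^{\mathbf EW}\|\rho_0^{\mathbf E}\otimes\rho^W_{\rm unif})\le\frac\ell q\Big(\frac{\dim\mathcal H^E}{\widetilde\lambda^E}-1\Big);$$ and, if $\ell\ge\ell_0$, 2. if $\lambda_{\min}(\chi)\ge\widetilde\lambda^\chi$ and $\lambda_{\min}(\mathcal E(\rho_0))\ge\widetilde\lambda^B$, then $\mathbb P(H=0)\le2^{-\xi\ell}$; 3. if $\lambda_{\min}(\chi)\le\widetilde\lambda^\chi-2\tau$ or $\lambda_{\min}(\mathcal E(\rho_0))\le\widetilde\lambda^B-2\tau$, then $\mathbb P(H=1)\le2^{-\xi\ell}$; 4. if $2\tau<\widetilde\lambda^\chi$, $\lambda_{\min}(\rho_0^E)\ge\widetilde\lambda^E$,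 $\lambda_{\min}(\chi)\ge\widetilde\lambda^\chi-2\tau$ and $\lambda_{\min}(\mathcal E(\rho_0))\ge\widetilde\lambda^B-2\tau$, then $$\mathbb P\big(D^B-2\tau\le\widehat D^B\le D^B\ \text{ and }\ D^E\le\widehat D^E\le D^E+2\tau\big)\ge1-2^{-\xi\ell}.$$ -/

import Mathlib

namespace CovertTomography

open scoped Matrix Kronecker ComplexOrder

noncomputable section

/-! ### States, channels, entropies -/

/-- Density operators on `ℂ^ι`, as matrices in the fixed orthonormal basis. -/
def IsDensity {ι : Type*} [Fintype ι] (ρ : Matrix ι ι ℂ) : Prop :=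
  ρ.PosSemidef ∧ ρ.trace = 1

/-- Quantum channels `L(ℂ^d) → L(ℂ^d)`: completely positive, trace preserving linear maps. Complete
positivity: `id_k ⊗ Φ` (acting blockwise) preserves positive semidefiniteness for every `k`. -/
def IsChannel {d : ℕ} (Φ : Matrix (Fin d) (Fin d) ℂ →ₗ[ℂ] Matrix (Fin d) (Fin d) ℂ) : Prop :=
  (∀ X, (Φ X).trace = X.trace) ∧
  ∀ (k : ℕ) (X : Matrix (Fin k × Fin d) (Fin k × Fin d) ℂ), X.PosSemidef →
    (Matrix.of fun (x y : Fin k × Fin d) =>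
      Φ (Matrix.of fun i j => X (x.1, i) (y.1, j)) x.2 y.2).PosSemidef

/-- `tr_E` on `B ⊗ E`. -/
def traceE {d e : ℕ} (X : Matrix (Fin d × Fin e) (Fin d × Fin e) ℂ) : Matrix (Fin d) (Fin d) ℂ :=
  Matrix.of fun i j => ∑ a, X (i, a) (j, a)

/-- `tr_B` on `B ⊗ E`. -/
def traceB {d e : ℕ} (X : Matrix (Fin d × Fin e) (Fin d × Fin e) ℂ) : Matrix (Fin e) (Fin e) ℂ :=
  Matrix.of fun a b => ∑ i, X (i, a) (i, b)

/-- `V : A → B ⊗ E` is an isometric extension of the channel `Φ`. -/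
def IsIsometricExtension {d e : ℕ} (V : Matrix (Fin d × Fin e) (Fin d) ℂ)
    (Φ : Matrix (Fin d) (Fin d) ℂ →ₗ[ℂ] Matrix (Fin d) (Fin d) ℂ) : Prop :=
  Vᴴ * V = 1 ∧ ∀ ρ, Φ ρ = traceE (V * ρ * Vᴴ)

/-- The complementary channel `ρ ↦ tr_B (V ρ V†)`: what Eve receives. -/
def complement {d e : ℕ} (V : Matrix (Fin d × Fin e) (Fin d) ℂ) (ρ : Matrix (Fin d) (Fin d) ℂ) :
    Matrix (Fin e) (Fin e) ℂ :=
  traceB (V * ρ * Vᴴ)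

/-- The smallest eigenvalue of a Hermitian matrix. -/
def lambdaMin {ι : Type*} [Fintype ι] [DecidableEq ι] (X : Matrix ι ι ℂ) : ℝ :=
  sInf (spectrum ℝ X)

open Classical in
/-- Quantum relative entropy `D(ρ‖σ) = tr ρ (log ρ - log σ)` if `supp ρ ⊆ supp σ`, i.e.
`ker σ ⊆ ker ρ`, and `∞` otherwise (natural logarithm, `0 log 0 = 0`). -/
def relEntropy {ι : Type*} [Fintype ι] [DecidableEq ι] (ρ σ : Matrix ι ι ℂ) : EReal :=
  if ∀ v : ι → ℂ, σ *ᵥ v = 0 → ρ *ᵥ v = 0 then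
    (((ρ * (cfc Real.log ρ - cfc Real.log σ)).trace.re : ℝ) : EReal)
  else ⊤

/-- The tensor product `⊗_t X_t` on `(ℂ^n)^{⊗ T}`. -/
def tensor {T n : ℕ} (X : Fin T → Matrix (Fin n) (Fin n) ℂ) :
    Matrix (Fin T → Fin n) (Fin T → Fin n) ℂ :=
  Matrix.of fun a b => ∏ t, X t (a t) (b t)

/-! ### The `χ` representation

The operator basis is `Ẽ_(n,m) = |n⟩⟨m|`, indexed by pairs. -/

/-- `Ẽ_(n,m) = |n⟩⟨m|`. -/
def opBasis {d : ℕ} (j : Fin d × Fin d) : Matrix (Fin d) (Fin d) ℂ := Matrix.single j.1 j.2 1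

/-- `ρ ↦ ∑_{j,k} χ_{j,k} Ẽ_j ρ Ẽ_k†`. -/
def applyChi {d : ℕ} (χ : Matrix (Fin d × Fin d) (Fin d × Fin d) ℂ)
    (ρ : Matrix (Fin d) (Fin d) ℂ) : Matrix (Fin d) (Fin d) ℂ :=
  ∑ j, ∑ k, χ j k • (opBasis j * ρ * (opBasis k)ᴴ)

/-- The linear map `χ_{j,k} = ∑ κ_{j,k}^{j',k'} λ_{j',k'}` that gives `χ` from the coefficients `λ`
of a linear map in the operator basis, `Ẽ_j ↦ ∑_k λ_{j,k} Ẽ_k`. See `applyChi_chi` and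
`chi_unique`. -/
def chiOfLambda {d : ℕ} (l : Fin d × Fin d → Fin d × Fin d → ℂ) :
    Matrix (Fin d × Fin d) (Fin d × Fin d) ℂ :=
  Matrix.of fun j k => l (j.2, k.2) (j.1, k.1)

/-- The `χ` matrix of a linear map; `(Φ Ẽ_j) k.1 k.2` is the coefficient of `Ẽ_k` in `Φ Ẽ_j`. -/
def chi {d : ℕ} (Φ : Matrix (Fin d) (Fin d) ℂ →ₗ[ℂ] Matrix (Fin d) (Fin d) ℂ) :
    Matrix (Fin d × Fin d) (Fin d × Fin d) ℂ :=
  chiOfLambda fun j k => Φ (opBasis j) k.1 k.2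

theorem applyChi_apply {d : ℕ} (χ : Matrix (Fin d × Fin d) (Fin d × Fin d) ℂ)
    (ρ : Matrix (Fin d) (Fin d) ℂ) (n n' : Fin d) :
    applyChi χ ρ n n' = ∑ m, ∑ m', χ (n, m) (n', m') * ρ m m' := by
  have h : ∀ j k : Fin d × Fin d, (opBasis j * ρ * (opBasis k)ᴴ) n n' =
      if n = j.1 ∧ n' = k.1 then ρ j.2 k.2 else 0 := by
    intro j k
    simp only [opBasis, Matrix.conjTranspose_single, star_one, Matrix.mul_apply, Matrix.single_apply]
    by_cases h1 : n = j.1 <;> by_cases h2 : n' = k.1 <;>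
      simp [h1, h2, eq_comm]
  simp only [applyChi, Matrix.sum_apply, Matrix.smul_apply, h, smul_eq_mul, Fintype.sum_prod_type]
  rw [Finset.sum_eq_single n]
  · refine Finset.sum_congr rfl fun m _ => ?_
    rw [Finset.sum_eq_single n']
    · simp
    · intro b _ hb
      simp [hb.symm]
    · simp
  · intro b _ hb
    simp [hb.symm]
  · simp

/-- `chi Φ` represents `Φ`. -/
theorem applyChi_chi {d : ℕ} (Φ : Matrix (Fin d) (Fin d) ℂ →ₗ[ℂ] Matrix (Fin d) (Fin d) ℂ)
    (ρ : Matrix (Fin d) (Fin d) ℂ) : applyChi (chi Φ) ρ = Φ ρ := by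
  ext n n'
  rw [applyChi_apply]
  conv_rhs => rw [Matrix.matrix_eq_sum_single ρ]
  simp only [map_sum, Matrix.sum_apply, chi, chiOfLambda, opBasis, Matrix.of_apply]
  refine Finset.sum_congr rfl fun m _ => Finset.sum_congr rfl fun m' _ => ?_
  have : Matrix.single m m' (ρ m m') = ρ m m' • Matrix.single m m' (1 : ℂ) := by
    simp [Matrix.smul_single]
  rw [this, map_smul, Matrix.smul_apply, smul_eq_mul, mul_comm]

/-- `chi Φ` is the only matrix that represents `Φ`. -/
theorem chi_unique {d : ℕ} (Φ : Matrix (Fin d) (Fin d) ℂ →ₗ[ℂ] Matrix (Fin d) (Fin d) ℂ)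
    (χ : Matrix (Fin d × Fin d) (Fin d × Fin d) ℂ) (h : ∀ ρ, applyChi χ ρ = Φ ρ) : χ = chi Φ := by
  ext ⟨n, m⟩ ⟨n', m'⟩
  simp only [chi, chiOfLambda, Matrix.of_apply, ← h, applyChi_apply, opBasis, Matrix.single_apply]
  rw [Finset.sum_eq_single m, Finset.sum_eq_single m']
  · simp
  · intro b _ hb
    simp [hb.symm]
  · simp
  · intro b _ hb
    simp [hb.symm]
  · simp

/-- The complementary map `ρ ↦ √χ* ρ̃ √χ*` of the completely positive map with matrix `χ`, where
`ρ̃_{j,k} = tr (Ẽ_j ρ Ẽ_k†)` and `*` is entrywise complex conjugation. It is the complement for the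
Kraus operators `∑_j (√χ)_{j,a} Ẽ_j`; other choices differ from it by an isometry. -/
def complementOfChi {d : ℕ} (χ : Matrix (Fin d × Fin d) (Fin d × Fin d) ℂ)
    (ρ : Matrix (Fin d) (Fin d) ℂ) : Matrix (Fin d × Fin d) (Fin d × Fin d) ℂ :=
  (cfc Real.sqrt χ).map star *
    (Matrix.of fun j k => (opBasis j * ρ * (opBasis k)ᴴ).trace) * (cfc Real.sqrt χ).map star

/-! ### The protocol -/

/-- Ordered pairs of distinct basis labels. -/
abbrev OffDiag (d : ℕ) : Type := {p : Fin d × Fin d // p.1 ≠ p.2}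

/-- Labels of the family `S` of probe states: `|n⟩`, then `|n,m,+⟩`, then `|n,m,-⟩` (`n ≠ m`). -/
abbrev Label (d : ℕ) : Type := Fin d ⊕ (OffDiag d ⊕ OffDiag d)

instance instDecidableEqLabel (d : ℕ) : DecidableEq (Label d) := inferInstance

theorem card_label (d : ℕ) : Fintype.card (Label d) = 2 * d ^ 2 - d := by
  have h : Fintype.card (OffDiag d) = d * d - d := by
    have h1 := Fintype.card_subtype_compl (fun p : Fin d × Fin d => p.1 = p.2)
    have h2 : Fintype.card {p : Fin d × Fin d // p.1 = p.2} = d := by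
      have : {p : Fin d × Fin d // p.1 = p.2} ≃ Fin d :=
        ⟨fun p => p.1.1, fun n => ⟨(n, n), rfl⟩, fun p => by
          rcases p with ⟨⟨a, b⟩, h⟩
          simp only at h
          subst h
          rfl, fun n => rfl⟩
      rw [Fintype.card_congr this, Fintype.card_fin]
    rw [h2, Fintype.card_prod, Fintype.card_fin] at h1
    exact h1
  rw [Fintype.card_sum, Fintype.card_sum, h, Fintype.card_fin]
  rcases Nat.eq_zero_or_pos d with h0 | h0
  · simp [h0]
  · have : d ≤ d * d := Nat.le_mul_of_pos_left d h0
    rw [pow_two]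
    omega

/-- The vector `|n⟩`, `(|n⟩ + |m⟩)/√2` or `(|n⟩ + i|m⟩)/√2`. -/
def probeVec {d : ℕ} : Label d → Fin d → ℂ
  | .inl n => Pi.single n 1
  | .inr (.inl p) => ((Real.sqrt 2 : ℝ) : ℂ)⁻¹ • (Pi.single p.1.1 1 + Pi.single p.1.2 1)
  | .inr (.inr p) => ((Real.sqrt 2 : ℝ) : ℂ)⁻¹ • (Pi.single p.1.1 1 + Complex.I • Pi.single p.1.2 1)

/-- The pure state `|v⟩⟨v|`. -/
def probe {d : ℕ} (s : Label d) : Matrix (Fin d) (Fin d) ℂ :=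
  Matrix.vecMulVec (probeVec s) (star (probeVec s))

/-- `ℓ̃ = ⌊⌊ℓ/|S|⌋/|S|⌋`, the number of times that each pair (state sent, test) is used. -/
def reps (d ℓ : ℕ) : ℕ := ℓ / Fintype.card (Label d) / Fintype.card (Label d)

/-- The agreed order: the state sent on each of the `ℓ` pulses and the test made on it. Each state
of `S` is sent `⌊ℓ/|S|⌋` times, and among these each test `{ρ̃, 1 - ρ̃}`, `ρ̃ ∈ S`, is made `ℓ̃` times.
On left-over pulses (`none`) the innocent state is sent, respectively no test is made. -/
structure Schedule (d ℓ : ℕ) where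
  prep : Fin ℓ → Option (Label d)
  test : Fin ℓ → Option (Label d)
  card_prep : ∀ s, (Finset.univ.filter fun k => prep k = some s).card
    = ℓ / Fintype.card (Label d)
  card_test : ∀ s t, (Finset.univ.filter fun k => prep k = some s ∧ test k = some t).card
    = reps d ℓ
  test_none : ∀ k, prep k = none → test k = none

/-- Is channel use `t` (counted from `0`) a pulse, and which one? Pulse `k` is sent on slot `u k` of
the block `k q, …, k q + q - 1`. -/
def pulseAt {ℓ q : ℕ} (u : Fin ℓ → Fin q) (t : ℕ) : Option (Fin ℓ) :=
  if h : t / q < ℓ then (if ((u ⟨t / q, h⟩ : Fin q) : ℕ) = t % q then some ⟨t / q, h⟩ else none)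
  else none

/-- The state that Alice sends on channel use `t` when the slots are `u`. -/
def sentAt {d ℓ q : ℕ} (ρ₀ : Matrix (Fin d) (Fin d) ℂ) (S : Schedule d ℓ) (u : Fin ℓ → Fin q)
    (t : ℕ) : Matrix (Fin d) (Fin d) ℂ :=
  match (pulseAt u t).bind S.prep with
  | none => ρ₀
  | some s => probe s

/-- Bob's results: one bit per pulse, `true` if the result of the test `{ρ̃, 1 - ρ̃}` is `ρ̃`
(always `true` if there is no test). -/
abbrev Outcome (ℓ : ℕ) : Type := Fin ℓ → Bool

/-- The element for the result `b` of the POVM `{ρ̃, 1 - ρ̃}`, or of the trivial one. -/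
def testEffect {d : ℕ} (t : Option (Label d)) (b : Bool) : Matrix (Fin d) (Fin d) ℂ :=
  match t with
  | none => if b then 1 else 0
  | some s => if b then probe s else 1 - probe s

/-- The factor on channel use `t` of Bob's product POVM for the slots `u`, with result `j`. -/
def effectAt {d ℓ q : ℕ} (S : Schedule d ℓ) (u : Fin ℓ → Fin q) (j : Outcome ℓ) (t : ℕ) :
    Matrix (Fin d) (Fin d) ℂ :=
  match pulseAt u t with
  | none => 1
  | some k => testEffect (S.test k) (j k)

open Classical in
/-- The probability that Bob's results satisfy `A`, in `T` channel uses: the slots are uniform and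
independent, and given the slots `u` Bob measures the state `Φ^{⊗T}(sent)`. -/
def prob {d ℓ q : ℕ} (T : ℕ) (Φ : Matrix (Fin d) (Fin d) ℂ →ₗ[ℂ] Matrix (Fin d) (Fin d) ℂ)
    (ρ₀ : Matrix (Fin d) (Fin d) ℂ) (S : Schedule d ℓ) (A : Outcome ℓ → Prop) : ℝ :=
  ((q : ℝ) ^ ℓ)⁻¹ * ∑ u : Fin ℓ → Fin q, ∑ j : Outcome ℓ,
    if A j then
      (tensor (fun t : Fin T => effectAt S u j t) *
        tensor (fun t : Fin T => Φ (sentAt ρ₀ S u t))).trace.re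
    else 0

/-- The joint state `ρ^{𝐄W}` of Eve's `T` outputs and of the public message `W`, which is any
encoding `g` in `b` bits of Bob's results, one-time padded with `b` uniform private bits. Given the
slots `u` and Bob's result `j`, Eve's (subnormalized) state is
`⊗_t tr_B ((M_t ⊗ 1) V ρ_t V†)`. -/
def stateEW {d e ℓ q b : ℕ} (T : ℕ) (V : Matrix (Fin d × Fin e) (Fin d) ℂ)
    (ρ₀ : Matrix (Fin d) (Fin d) ℂ) (S : Schedule d ℓ) (g : Outcome ℓ → (Fin b → ZMod 2)) :
    Matrix ((Fin T → Fin e) × (Fin b → ZMod 2)) ((Fin T → Fin e) × (Fin b → ZMod 2)) ℂ :=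
  ((q : ℂ) ^ ℓ)⁻¹ • ((2 : ℂ) ^ b)⁻¹ •
    ∑ u : Fin ℓ → Fin q, ∑ key : Fin b → ZMod 2, ∑ j : Outcome ℓ,
      tensor (fun t : Fin T =>
        traceB ((effectAt S u j t ⊗ₖ (1 : Matrix (Fin e) (Fin e) ℂ)) *
          (V * sentAt ρ₀ S u t * Vᴴ))) ⊗ₖ
      Matrix.single (g j + key) (g j + key) (1 : ℂ)

/-- `ρ_unif^W` on `b` bits. -/
def uniformW (b : ℕ) : Matrix (Fin b → ZMod 2) (Fin b → ZMod 2) ℂ := ((2 : ℂ) ^ b)⁻¹ • 1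

/-! ### The estimators -/

/-- `f̂(ρ,ρ̃) = N̂(ρ,ρ̃)/ℓ̃`. -/
def freq {d ℓ : ℕ} (S : Schedule d ℓ) (j : Outcome ℓ) (s t : Label d) : ℝ :=
  ((Finset.univ.filter fun k => S.prep k = some s ∧ S.test k = some t ∧ j k = true).card : ℝ)
    / (reps d ℓ : ℝ)

/-- `Ê(ρ)` for a state of `S`, from the frequencies `f = f̂(ρ,·)` of its tests. -/
def estProbe {d : ℕ} (f : Label d → ℝ) : Matrix (Fin d) (Fin d) ℂ :=
  Matrix.of fun n m =>
    if h : n ≠ m then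
      (f (.inr (.inl ⟨(n, m), h⟩)) : ℂ) - Complex.I * f (.inr (.inr ⟨(n, m), h⟩))
        - (1 - Complex.I) / 2 * f (.inl n) - (1 - Complex.I) / 2 * f (.inl m)
    else f (.inl n)

/-- `Ê(Ẽ_(n,m))`. -/
def estBasis {d : ℕ} (f : Label d → Label d → ℝ) (p : Fin d × Fin d) :
    Matrix (Fin d) (Fin d) ℂ :=
  if h : p.1 ≠ p.2 then
    estProbe (f (.inr (.inl ⟨p, h⟩))) + Complex.I • estProbe (f (.inr (.inr ⟨p, h⟩)))
      - ((1 + Complex.I) / 2) • estProbe (f (.inl p.1))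
      - ((1 + Complex.I) / 2) • estProbe (f (.inl p.2))
  else estProbe (f (.inl p.1))

/-- `χ̂`, obtained from the coefficients `λ̂` of the `Ê(Ẽ_j)`. The empirical matrix need not be
Hermitian, so its Hermitian part is taken. -/
def chiHat {d : ℕ} (f : Label d → Label d → ℝ) : Matrix (Fin d × Fin d) (Fin d × Fin d) ℂ :=
  (1 / 2 : ℂ) • (chiOfLambda (fun j k => estBasis f j k.1 k.2) +
    (chiOfLambda (fun j k => estBasis f j k.1 k.2))ᴴ)

open Classical in
/-- `H = 1` (continue) or `H = 0` (abort). -/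
def testH {d ℓ : ℕ} (lχ lB τ : ℝ) (ρ₀ : Matrix (Fin d) (Fin d) ℂ) (S : Schedule d ℓ)
    (j : Outcome ℓ) : ℕ :=
  if lχ - τ ≤ lambdaMin (chiHat (freq S j)) ∧
      lB - τ ≤ lambdaMin (applyChi (chiHat (freq S j)) ρ₀) then 1 else 0

/-- `D̂^B = D(Ê(ρ₁)‖Ê(ρ₀)) - τ`. -/
def estB {d ℓ : ℕ} (τ : ℝ) (ρ₀ ρ₁ : Matrix (Fin d) (Fin d) ℂ) (S : Schedule d ℓ)
    (j : Outcome ℓ) : EReal :=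
  relEntropy (applyChi (chiHat (freq S j)) ρ₁) (applyChi (chiHat (freq S j)) ρ₀) - (τ : EReal)

/-- `D̂^E = D(Ê†(ρ₁)‖Ê†(ρ₀)) + τ`. -/
def estE {d ℓ : ℕ} (τ : ℝ) (ρ₀ ρ₁ : Matrix (Fin d) (Fin d) ℂ) (S : Schedule d ℓ)
    (j : Outcome ℓ) : EReal :=
  relEntropy (complementOfChi (chiHat (freq S j)) ρ₁) (complementOfChi (chiHat (freq S j)) ρ₀)
    + (τ : EReal)

end

end CovertTomography

open CovertTomography
open scoped Matrix Kronecker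

namespace CovertTomography

open scoped Matrix Kronecker ComplexOrder MatrixOrder

noncomputable section

/-! ### Spectral bounds and the Rényi bound on relative entropy -/

section Spectral

variable {n : Type*} [Fintype n] [DecidableEq n]

/-! Covertness. Averaging over the one-time pad makes the message uniform whatever Bob found, and
summing over his results turns his measurement into the identity, so the joint state is a product of
Eve's averaged state and the uniform one (`stateEW_eq`). Relative entropy is at most `log tr ρ²σ⁻¹`
(`entropyDiff_le_log`), a second moment that can be computed exactly for a mixture over pulse
positions. Expand the square over two independent position vectors: a channel use on which at most
one of them has a pulse contributes a factor `1`, and a coincidence in block `k`, of probability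
`1/q`, contributes `c_k = tr ω_k²σ⁻¹`, where `ω_k` is Eve's output for pulse `k` and `σ` her
innocent output. Hence the moment is `∏ (1 + (c_k - 1)/q)` (`trace_stateE_sq`). Since `ω_k² ≤ ω_k`
and `σ⁻¹ ≤ 1/λ`, each `c_k` is at most `1/λ`, and `log y ≤ y - 1` gives the bound, linear in `ℓ/q`.

Estimation. Bob's results are independent bits whose law does not depend on the pulse positions
(`prob_eq_sum_prod`). Exponential tails and a union bound put all frequencies within `ε` of their
probabilities, except with exponentially small probability (`prob_not_freqClose_le`,
`exists_exponent`). On this good event everything is deterministic: polarization recovers `χ`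
exactly from the exact probabilities (`chiHat_probeProb`), it is stable entrywise
(`norm_chiHat_sub_le`), and smallest eigenvalues are Lipschitz.

For the two relative entropies the modulus of continuity must not depend on the channel or on Eve's
space. At Bob, all matrices involved stay in a compact set with spectrum away from zero, so uniform
continuity suffices. At Eve, full rank of `χ` and of her innocent output makes the complementary
channel unitarily equivalent to the one built from `√χ` (`exists_unitary_complement`). Her entropies
then become functions of matrices of the fixed size `d²`, and compactness applies again
(`exists_accuracy`). -/

theorem le_iff_le_spectrum {X : Matrix n n ℂ} (hX : X.IsHermitian) (c : ℝ) :
    algebraMap ℝ (Matrix n n ℂ) c ≤ X ↔ ∀ x ∈ spectrum ℝ X, c ≤ x :=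
  algebraMap_le_iff_le_spectrum (a := X) hX

theorem le_lambdaMin_iff [Nonempty n] {X : Matrix n n ℂ} (hX : X.IsHermitian) (c : ℝ) :
    c ≤ lambdaMin X ↔ algebraMap ℝ (Matrix n n ℂ) c ≤ X := by
  rw [le_iff_le_spectrum hX, lambdaMin, hX.spectrum_real_eq_range_eigenvalues]
  rw [le_csInf_iff (Set.finite_range _).bddBelow (Set.range_nonempty _)]

open scoped Matrix.Norms.L2Operator in
theorem lambdaMin_le_add [Nonempty n] {X Y : Matrix n n ℂ} (hX : X.IsHermitian)
    (hY : Y.IsHermitian) : lambdaMin Y - ‖X - Y‖ ≤ lambdaMin X := by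
  rw [le_lambdaMin_iff hX]
  have h1 := (le_lambdaMin_iff hY _).1 le_rfl
  have h2 := IsSelfAdjoint.neg_algebraMap_norm_le_self (a := X - Y) (hX.sub hY)
  have := add_le_add h1 h2
  simpa [sub_eq_add_neg] using this

theorem posDef_of_algebraMap_le {X : Matrix n n ℂ} {c : ℝ} (hc : 0 < c)
    (h : algebraMap ℝ (Matrix n n ℂ) c ≤ X) : X.PosDef := by
  have h1 : (algebraMap ℝ (Matrix n n ℂ) c).PosDef := by
    rw [Algebra.algebraMap_eq_smul_one]
    exact Matrix.PosDef.one.smul hc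
  have := h1.add_posSemidef (Matrix.le_iff.1 h)
  simpa using this

/-- The quantum relative entropy of a pair with full-rank second argument, as a real number. -/
def entropyDiff (ρ σ : Matrix n n ℂ) : ℝ := (ρ * (cfc Real.log ρ - cfc Real.log σ)).trace.re

theorem relEntropy_of_posDef (ρ : Matrix n n ℂ) {σ : Matrix n n ℂ} (hσ : σ.PosDef) :
    relEntropy ρ σ = (entropyDiff ρ σ : EReal) := by
  rw [relEntropy, if_pos, entropyDiff]
  intro v hv
  have : v = 0 := by
    have h := hσ.isUnit
    exact Matrix.mulVec_injective_of_isUnit h (by simpa using hv)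
  simp [this]

/-- The weights are the squared overlaps of the two eigenbases. They are the same for all `f` and
`g`, so traces of noncommuting pairs become classical double sums. -/
theorem exists_joint_weights {ρ σ : Matrix n n ℂ} (hρ : ρ.IsHermitian) (hσ : σ.IsHermitian) :
    ∃ w : n → n → ℝ, (∀ i j, 0 ≤ w i j) ∧ ∀ f g : ℝ → ℝ, (cfc f ρ * cfc g σ).trace =
      ((∑ i, ∑ j, w i j * (f (hρ.eigenvalues i) * g (hσ.eigenvalues j)) : ℝ) : ℂ) := by
  set U : Matrix n n ℂ := hρ.eigenvectorUnitary.1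
  set W : Matrix n n ℂ := hσ.eigenvectorUnitary.1
  refine ⟨fun i j => Complex.normSq ((Uᴴ * W) i j), fun i j => Complex.normSq_nonneg _, ?_⟩
  intro f g
  have h1 : cfc f ρ = U * Matrix.diagonal (fun i => ((f (hρ.eigenvalues i) : ℝ) : ℂ)) * Uᴴ := by
    rw [hρ.cfc_eq]; rfl
  have h2 : cfc g σ = W * Matrix.diagonal (fun i => ((g (hσ.eigenvalues i) : ℝ) : ℂ)) * Wᴴ := by
    rw [hσ.cfc_eq]; rfl
  have h3 : ∀ D E : Matrix n n ℂ, (U * D * Uᴴ * (W * E * Wᴴ)).trace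
      = (D * (Uᴴ * W) * E * (Uᴴ * W)ᴴ).trace := by
    intro D E
    rw [Matrix.conjTranspose_mul, Matrix.conjTranspose_conjTranspose]
    simp only [Matrix.mul_assoc]
    rw [Matrix.trace_mul_comm U]
    simp only [Matrix.mul_assoc]
  rw [h1, h2, h3, Matrix.trace]
  push_cast
  refine Finset.sum_congr rfl fun i _ => ?_
  rw [Matrix.diag_apply, Matrix.mul_apply]
  refine Finset.sum_congr rfl fun j _ => ?_
  rw [Matrix.mul_diagonal, Matrix.diagonal_mul, Matrix.conjTranspose_apply,
    Complex.normSq_eq_conj_mul_self]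
  simp only [RCLike.star_def]
  ring

theorem mul_cfc_log {ρ : Matrix n n ℂ} (hρ : ρ.IsHermitian) :
    ρ * cfc Real.log ρ = cfc (fun x => x * Real.log x) ρ := by
  have hf : ∀ f : ℝ → ℝ, ContinuousOn f (spectrum ℝ ρ) := fun f => ρ.finite_real_spectrum.continuousOn f
  rw [cfc_mul (fun x : ℝ => x) Real.log ρ (hf _) (hf _), cfc_id' ℝ ρ hρ.isSelfAdjoint]

/-- The numbers `w i j * p i` form a probability distribution. Under it, `tr ρ²σ⁻¹` is the mean of
the likelihood ratio `p i / s j` and the relative entropy is the mean of its logarithm, which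
reduces their comparison to Jensen's inequality. -/
theorem exists_joint_distribution {ρ σ : Matrix n n ℂ} (hρ : IsDensity ρ) (hσ : σ.PosDef) :
    ∃ w : n → n → ℝ, (∀ i j, 0 ≤ w i j) ∧ ∑ i, ∑ j, w i j * hρ.1.isHermitian.eigenvalues i = 1 ∧
      (ρ * ρ * σ⁻¹).trace = ((∑ i, ∑ j, w i j * (hρ.1.isHermitian.eigenvalues i *
        hρ.1.isHermitian.eigenvalues i * (hσ.isHermitian.eigenvalues j)⁻¹) : ℝ) : ℂ) ∧
      entropyDiff ρ σ = ∑ i, ∑ j, w i j * (hρ.1.isHermitian.eigenvalues i *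
        (Real.log (hρ.1.isHermitian.eigenvalues i) - Real.log (hσ.isHermitian.eigenvalues j))) := by
  have hρh := hρ.1.isHermitian
  have hσh := hσ.isHermitian
  have hf : ∀ f : ℝ → ℝ, ContinuousOn f (spectrum ℝ ρ) := fun f => ρ.finite_real_spectrum.continuousOn f
  have hg : ∀ f : ℝ → ℝ, ContinuousOn f (spectrum ℝ σ) := fun f => σ.finite_real_spectrum.continuousOn f
  obtain ⟨w, hw, hwt⟩ := exists_joint_weights hρh hσh
  set p := hρh.eigenvalues
  set s := hσh.eigenvalues
  have hs : ∀ i, 0 < s i := hσ.eigenvalues_pos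
  have e1 : ∑ i, ∑ j, w i j * p i = 1 := by
    have := hwt (fun x => x) (fun _ => 1)
    rw [cfc_id' ℝ ρ hρh.isSelfAdjoint, cfc_const_one ℝ σ, mul_one, hρ.2] at this
    simp only [mul_one] at this
    exact_mod_cast this.symm
  have e2 : (ρ * ρ * σ⁻¹).trace = ((∑ i, ∑ j, w i j * (p i * p i * (s j)⁻¹) : ℝ) : ℂ) := by
    have := hwt (fun x => x * x) (fun x => x⁻¹)
    have hinv : cfc (fun x : ℝ => x⁻¹) σ = σ⁻¹ := by
      symm
      apply Matrix.inv_eq_left_inv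
      have := cfc_mul (fun x : ℝ => x⁻¹) (fun x => x) σ (hg _) (hg _)
      rw [cfc_id' ℝ σ hσh.isSelfAdjoint] at this
      rw [← this, ← cfc_const_one ℝ σ]
      apply cfc_congr
      intro x hx
      rw [hσh.spectrum_real_eq_range_eigenvalues] at hx
      obtain ⟨i, rfl⟩ := hx
      exact inv_mul_cancel₀ (hs i).ne'
    rw [cfc_mul (fun x : ℝ => x) (fun x => x) ρ (hf _) (hf _), cfc_id' ℝ ρ hρh.isSelfAdjoint, hinv] at this
    exact this
  have e3 : entropyDiff ρ σ = ∑ i, ∑ j, w i j * (p i * (Real.log (p i) - Real.log (s j))) := by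
    have h1 := hwt (fun x => x * Real.log x) (fun _ => 1)
    have h2 := hwt (fun x => x) Real.log
    rw [cfc_const_one ℝ σ, mul_one, ← mul_cfc_log hρh] at h1
    rw [cfc_id' ℝ ρ hρh.isSelfAdjoint] at h2
    rw [entropyDiff, mul_sub, Matrix.trace_sub, h1, h2, ← Complex.ofReal_sub, Complex.ofReal_re,
      ← Finset.sum_sub_distrib]
    refine Finset.sum_congr rfl fun i _ => ?_
    rw [← Finset.sum_sub_distrib]
    refine Finset.sum_congr rfl fun j _ => ?_
    ring
  exact ⟨w, hw, e1, e2, e3⟩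

theorem le_of_algebraMap_le {X : Matrix n n ℂ} (hX : X.IsHermitian) {c : ℝ}
    (h : algebraMap ℝ (Matrix n n ℂ) c ≤ X) (i : n) : c ≤ hX.eigenvalues i :=
  (le_iff_le_spectrum hX c).1 h _ (hX.eigenvalues_mem_spectrum_real i)

theorem eigenvalues_le_one {ρ : Matrix n n ℂ} (hρ : IsDensity ρ) (i : n) :
    hρ.1.isHermitian.eigenvalues i ≤ 1 := by
  have h := hρ.2.symm.trans hρ.1.isHermitian.trace_eq_sum_eigenvalues
  have h1 : ∑ i, hρ.1.isHermitian.eigenvalues i = 1 := by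
    simpa using (congrArg Complex.re h).symm
  rw [← h1]
  exact Finset.single_le_sum (fun i _ => hρ.1.eigenvalues_nonneg i) (Finset.mem_univ i)

/-- Termwise in the joint sum: `p² ≤ p` because eigenvalues of a density are at most one, and `s⁻¹ ≤
c⁻¹`. The real witness records that the complex trace is real. -/
theorem trace_sq_mul_inv_le {ω σ : Matrix n n ℂ} (hω : IsDensity ω) {c : ℝ} (hc : 0 < c)
    (hσ : algebraMap ℝ (Matrix n n ℂ) c ≤ σ) :
    ∃ r : ℝ, (ω * ω * σ⁻¹).trace = r ∧ 0 ≤ r ∧ r ≤ c⁻¹ := by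
  have hσ' := posDef_of_algebraMap_le hc hσ
  obtain ⟨w, hw, e1, e2, -⟩ := exists_joint_distribution hω hσ'
  have hp := hω.1.eigenvalues_nonneg
  have hs := fun j => hσ'.eigenvalues_pos j
  refine ⟨_, e2, Finset.sum_nonneg fun i _ => Finset.sum_nonneg fun j _ => mul_nonneg (hw i j)
    (mul_nonneg (mul_nonneg (hp i) (hp i)) (inv_nonneg.2 (hs j).le)), ?_⟩
  rw [← one_mul c⁻¹, ← e1, Finset.sum_mul]
  refine Finset.sum_le_sum fun i _ => ?_
  rw [Finset.sum_mul]
  refine Finset.sum_le_sum fun j _ => ?_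
  rw [mul_assoc (w i j)]
  refine mul_le_mul_of_nonneg_left ?_ (hw i j)
  refine mul_le_mul (mul_le_of_le_one_right (hp i) (eigenvalues_le_one hω i))
    (inv_anti₀ hc (le_of_algebraMap_le hσ'.isHermitian hσ j)) (inv_nonneg.2 (hs j).le) (hp i)

/-- The relative entropy is at most the Rényi relative entropy of order two. -/
theorem entropyDiff_le_log {ρ σ : Matrix n n ℂ} (hρ : IsDensity ρ) (hσ : σ.PosDef) :
    entropyDiff ρ σ ≤ Real.log (ρ * ρ * σ⁻¹).trace.re := by
  obtain ⟨w, hw, e1, e2', e3⟩ := exists_joint_distribution hρ hσ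
  have hp := hρ.1.eigenvalues_nonneg
  have hs := fun j => hσ.eigenvalues_pos j
  set p := hρ.1.isHermitian.eigenvalues
  set s := hσ.isHermitian.eigenvalues
  have e2 : (ρ * ρ * σ⁻¹).trace.re = ∑ i, ∑ j, w i j * (p i * p i * (s j)⁻¹) := by
    rw [e2', Complex.ofReal_re]
  set c := (ρ * ρ * σ⁻¹).trace.re
  have hterm : ∀ i j, 0 ≤ w i j * (p i * p i * (s j)⁻¹) := fun i j =>
    mul_nonneg (hw i j) (mul_nonneg (mul_nonneg (hp i) (hp i)) (inv_nonneg.2 (hs j).le))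
  -- If the second moment vanished, every term of the sum would, and with it the total mass `∑ w p =
  -- 1`.
  have hc : 0 < c := by
    rw [e2]
    refine lt_of_le_of_ne (Finset.sum_nonneg fun i _ => Finset.sum_nonneg fun j _ => hterm i j) ?_
    intro h0
    have h0' := (Finset.sum_eq_zero_iff_of_nonneg
      (fun i _ => Finset.sum_nonneg fun j _ => hterm i j)).1 h0.symm
    have : ∑ i, ∑ j, w i j * p i = 0 := by
      refine Finset.sum_eq_zero fun i hi => Finset.sum_eq_zero fun j hj => ?_
      have h1 := (Finset.sum_eq_zero_iff_of_nonneg (fun j _ => hterm i j)).1 (h0' i hi) j hj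
      have h2 := (inv_pos.2 (hs j)).ne'
      rcases mul_eq_zero.1 h1 with h | h
      · simp [h]
      · rcases mul_eq_zero.1 h with h | h
        · simp [mul_self_eq_zero.1 h]
        · exact absurd h h2
    linarith
  -- Jensen by a tangent line: `log x ≤ x - 1` at `x = p / (s c)`, weighted by `w p`. Summation
  -- leaves `c · c⁻¹ + log c - 1`.
  have key : ∀ i j, w i j * (p i * (Real.log (p i) - Real.log (s j))) ≤
      w i j * (p i * p i * (s j)⁻¹) * c⁻¹ + w i j * p i * (Real.log c - 1) := by
    intro i j
    rcases (hp i).eq_or_lt with h | h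
    · simp [← h]
    · have hpos : 0 < p i * (s j)⁻¹ * c⁻¹ := by have := hs j; positivity
      have hl := Real.log_le_sub_one_of_pos hpos
      rw [Real.log_mul (by have := hs j; positivity) (by positivity),
        Real.log_mul h.ne' (inv_pos.2 (hs j)).ne', Real.log_inv, Real.log_inv] at hl
      have := mul_le_mul_of_nonneg_left hl (mul_nonneg (hw i j) h.le)
      nlinarith [this]
  calc entropyDiff ρ σ ≤ ∑ i, ∑ j, (w i j * (p i * p i * (s j)⁻¹) * c⁻¹
        + w i j * p i * (Real.log c - 1)) := by
        rw [e3]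
        exact Finset.sum_le_sum fun i _ => Finset.sum_le_sum fun j _ => key i j
    _ = Real.log c := by
        have e1' : ∑ i, (∑ j, w i j) * p i = 1 := by
          simpa only [Finset.sum_mul] using e1
        simp only [Finset.sum_add_distrib, ← Finset.sum_mul]
        rw [← e2, e1', mul_inv_cancel₀ hc.ne']
        ring

end Spectral

/-! ### Tensor products -/

section Tensor

variable {T n : ℕ}

theorem tensor_mul (X Y : Fin T → Matrix (Fin n) (Fin n) ℂ) :
    tensor X * tensor Y = tensor fun t => X t * Y t := by
  ext a b
  simp only [tensor, Matrix.mul_apply, Matrix.of_apply, ← Finset.prod_mul_distrib]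
  rw [Finset.prod_univ_sum, Fintype.piFinset_univ]

theorem trace_tensor (X : Fin T → Matrix (Fin n) (Fin n) ℂ) :
    (tensor X).trace = ∏ t, (X t).trace := by
  simp only [tensor, Matrix.trace, Matrix.diag_apply, Matrix.of_apply]
  rw [Finset.prod_univ_sum, Fintype.piFinset_univ]

theorem tensor_one : tensor (fun _ : Fin T => (1 : Matrix (Fin n) (Fin n) ℂ)) = 1 := by
  ext a b
  simp only [tensor, Matrix.of_apply, Matrix.one_apply]
  by_cases h : a = b
  · simp [h]
  · obtain ⟨t, ht⟩ := Function.ne_iff.1 h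
    rw [if_neg h]
    exact Finset.prod_eq_zero (Finset.mem_univ t) (if_neg ht)

theorem conjTranspose_tensor (X : Fin T → Matrix (Fin n) (Fin n) ℂ) :
    (tensor X)ᴴ = tensor fun t => (X t)ᴴ := by
  ext a b
  simp [tensor, Matrix.conjTranspose_apply]

theorem posSemidef_tensor {X : Fin T → Matrix (Fin n) (Fin n) ℂ} (h : ∀ t, (X t).PosSemidef) :
    (tensor X).PosSemidef := by
  choose B hB using fun t => CStarAlgebra.nonneg_iff_eq_star_mul_self.1 (h t).nonneg
  have : tensor X = (tensor B)ᴴ * tensor B := by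
    rw [conjTranspose_tensor, tensor_mul]
    congr 1
    funext t
    exact hB t
  rw [this]
  exact Matrix.posSemidef_conjTranspose_mul_self _

theorem tensor_mul_tensor_inv {X : Matrix (Fin n) (Fin n) ℂ} (h : X.PosDef) :
    tensor (fun _ : Fin T => X) * tensor (fun _ : Fin T => X⁻¹) = 1 := by
  rw [tensor_mul, Matrix.mul_nonsing_inv _ ((Matrix.isUnit_iff_isUnit_det _).1 h.isUnit), tensor_one]

theorem posDef_tensor {X : Matrix (Fin n) (Fin n) ℂ} (h : X.PosDef) :
    (tensor (fun _ : Fin T => X)).PosDef :=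
  (posSemidef_tensor fun _ => h.posSemidef).posDef_iff_isUnit.2
    (IsUnit.of_mul_eq_one _ (tensor_mul_tensor_inv h))

end Tensor

theorem trace_mul_nonneg {n : Type*} [Fintype n] [DecidableEq n] {A B : Matrix n n ℂ}
    (hA : A.PosSemidef) (hB : B.PosSemidef) : 0 ≤ (A * B).trace := by
  obtain ⟨C, hC⟩ := CStarAlgebra.nonneg_iff_eq_star_mul_self.1 hA.nonneg
  rw [hC, Matrix.mul_assoc, Matrix.trace_mul_comm]
  exact (hB.mul_mul_conjTranspose_same C).trace_nonneg

/-! ### Pulse positions -/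

section Pulses

variable {ℓ q T : ℕ}

theorem pulseAt_eq_some_iff (u : Fin ℓ → Fin q) (t : ℕ) (k : Fin ℓ) :
    pulseAt u t = some k ↔ t = q * k + u k := by
  have hq : 0 < q := Fin.pos (u k)
  unfold pulseAt
  constructor
  · intro h
    split_ifs at h with h1 h2
    have hk : (⟨t / q, h1⟩ : Fin ℓ) = k := by simpa using h
    subst hk
    rw [h2]
    exact (Nat.div_add_mod t q).symm
  · rintro rfl
    have h1 : (q * k + u k) / q = k := by
      rw [Nat.mul_add_div hq, Nat.div_eq_of_lt (u k).2, add_zero]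
    have h2 : (q * (k : ℕ) + u k) % q = u k := by
      rw [Nat.mul_add_mod, Nat.mod_eq_of_lt (u k).2]
    simp [h1, h2]

theorem slot_lt (hT : q * ℓ ≤ T) (u : Fin ℓ → Fin q) (k : Fin ℓ) : q * (k : ℕ) + u k < T := by
  have h1 : q * ((k : ℕ) + 1) ≤ q * ℓ := Nat.mul_le_mul_left q k.2
  have := (u k).2
  rw [mul_add, mul_one] at h1
  omega

/-- The channel use on which pulse `k` is sent. -/
def slot (hT : q * ℓ ≤ T) (u : Fin ℓ → Fin q) (k : Fin ℓ) : Fin T := ⟨q * k + u k, slot_lt hT u k⟩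

theorem pulseAt_slot (hT : q * ℓ ≤ T) (u : Fin ℓ → Fin q) (k : Fin ℓ) :
    pulseAt u (slot hT u k) = some k :=
  (pulseAt_eq_some_iff u _ k).2 rfl

/-- Each pulse occupies exactly one channel use, and `q * ℓ ≤ T` keeps all of them in range, so a
product over channel uses splits into pulses and idle uses. -/
theorem prod_pulseAt {M : Type*} [CommMonoid M] (hT : q * ℓ ≤ T) (u : Fin ℓ → Fin q)
    (F : Fin T → Option (Fin ℓ) → M) :
    ∏ t : Fin T, F t (pulseAt u t) = (∏ k, F (slot hT u k) (some k)) *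
      ∏ t ∈ Finset.univ.filter (fun t : Fin T => pulseAt u t = none), F t none := by
  rw [← Finset.prod_filter_mul_prod_filter_not Finset.univ (fun t : Fin T => pulseAt u t = none),
    mul_comm]
  congr 1
  · symm
    refine Finset.prod_bij (fun k _ => slot hT u k) ?_ ?_ ?_ ?_
    · intro k _
      simp [pulseAt_slot]
    · intro k _ k' _ h
      have := pulseAt_slot hT u k
      rw [h, pulseAt_slot] at this
      simpa using this.symm
    · intro t ht
      obtain ⟨k, hk⟩ := Option.ne_none_iff_exists'.1 (Finset.mem_filter.1 ht).2
      exact ⟨k, Finset.mem_univ _, Fin.ext ((pulseAt_eq_some_iff u _ k).1 hk).symm⟩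
    · intro k _
      rw [pulseAt_slot]
  · refine Finset.prod_congr rfl fun t ht => ?_
    rw [(Finset.mem_filter.1 ht).2]

theorem prod_elim_pulseAt {M : Type*} [CommMonoid M] (hT : q * ℓ ≤ T) (u : Fin ℓ → Fin q)
    (f : Fin ℓ → M) : ∏ t : Fin T, (pulseAt u t).elim 1 f = ∏ k, f k := by
  rw [prod_pulseAt hT u fun _ o => o.elim 1 f]
  simp

theorem sum_prod_pulseAt {R : Type*} [CommSemiring R] (hT : q * ℓ ≤ T) (u : Fin ℓ → Fin q)
    (c : Fin T → R) (h : Fin T → Fin ℓ → Bool → R) :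
    ∑ j : Outcome ℓ, ∏ t : Fin T, (pulseAt u t).elim (c t) (fun k => h t k (j k)) =
      ∏ t : Fin T, (pulseAt u t).elim (c t) (fun k => ∑ b, h t k b) := by
  rw [prod_pulseAt hT u fun t o => o.elim (c t) (fun k => ∑ b, h t k b)]
  have := fun j : Outcome ℓ => prod_pulseAt hT u fun t o => o.elim (c t) (fun k => h t k (j k))
  simp only [this, Option.elim_some, Option.elim_none]
  rw [← Finset.sum_mul, Finset.prod_univ_sum, Fintype.piFinset_univ]

end Pulses

/-! ### Probes and tests -/

section Probes

variable {d ℓ q : ℕ}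

theorem inv_sqrt_two_mul_self :
    ((Real.sqrt 2 : ℝ) : ℂ)⁻¹ * ((Real.sqrt 2 : ℝ) : ℂ)⁻¹ = 1 / 2 := by
  rw [← mul_inv, ← Complex.ofReal_mul, Real.mul_self_sqrt (by norm_num)]
  norm_num

theorem star_probeVec_dotProduct (s : Label d) : star (probeVec s) ⬝ᵥ probeVec s = 1 := by
  have h2 := inv_sqrt_two_mul_self
  rcases s with n | ⟨⟨⟨n, m⟩, h⟩⟩ | ⟨⟨⟨n, m⟩, h⟩⟩
  · simp [probeVec]
  · simp only [ne_eq] at h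
    simp [probeVec, dotProduct_add, h, Ne.symm h]
    linear_combination 2 * h2
  · simp only [ne_eq] at h
    simp [probeVec, dotProduct_add, h, Ne.symm h]
    linear_combination 2 * h2 - ((Real.sqrt 2 : ℝ) : ℂ)⁻¹ ^ 2 * Complex.I_sq

theorem posSemidef_probe (s : Label d) : (probe s).PosSemidef :=
  Matrix.posSemidef_vecMulVec_self_star _

theorem isDensity_probe (s : Label d) : IsDensity (probe s) := by
  refine ⟨posSemidef_probe s, ?_⟩
  rw [probe, Matrix.trace_vecMulVec, dotProduct_comm, star_probeVec_dotProduct]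

theorem probe_mul_probe (s : Label d) : probe s * probe s = probe s := by
  rw [probe, Matrix.vecMulVec_mul_vecMulVec, star_probeVec_dotProduct, one_smul]

theorem posSemidef_one_sub_probe (s : Label d) : (1 - probe s).PosSemidef := by
  have h : 1 - probe s = (1 - probe s)ᴴ * (1 - probe s) := by
    rw [Matrix.conjTranspose_sub, Matrix.conjTranspose_one, (posSemidef_probe s).isHermitian.eq,
      sub_mul, mul_sub, mul_sub, probe_mul_probe]
    simp
  rw [h]
  exact Matrix.posSemidef_conjTranspose_mul_self _

theorem posSemidef_testEffect (t : Option (Label d)) (b : Bool) : (testEffect t b).PosSemidef := by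
  rcases t with _ | s <;> cases b <;>
    simp [testEffect, Matrix.PosSemidef.one, Matrix.PosSemidef.zero, posSemidef_probe,
      posSemidef_one_sub_probe]

theorem sum_testEffect (t : Option (Label d)) : ∑ b, testEffect t b = 1 := by
  rcases t with _ | s <;> simp [testEffect]

/-- The state sent on pulse `k`. -/
def sentPulse (ρ₀ : Matrix (Fin d) (Fin d) ℂ) (S : Schedule d ℓ) (k : Fin ℓ) :
    Matrix (Fin d) (Fin d) ℂ :=
  (S.prep k).elim ρ₀ probe

theorem isDensity_sentPulse {ρ₀ : Matrix (Fin d) (Fin d) ℂ} (h : IsDensity ρ₀) (S : Schedule d ℓ)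
    (k : Fin ℓ) : IsDensity (sentPulse ρ₀ S k) := by
  unfold sentPulse
  rcases S.prep k with _ | s
  · exact h
  · exact isDensity_probe s

theorem sentAt_eq (ρ₀ : Matrix (Fin d) (Fin d) ℂ) (S : Schedule d ℓ) (u : Fin ℓ → Fin q) (t : ℕ) :
    sentAt ρ₀ S u t = (pulseAt u t).elim ρ₀ (sentPulse ρ₀ S) := by
  unfold sentAt sentPulse
  rcases pulseAt u t with _ | k
  · rfl
  · rcases h : S.prep k with _ | s <;> simp [h]

theorem effectAt_eq (S : Schedule d ℓ) (u : Fin ℓ → Fin q) (j : Outcome ℓ) (t : ℕ) :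
    effectAt S u j t = (pulseAt u t).elim 1 (fun k => testEffect (S.test k) (j k)) := by
  unfold effectAt
  rcases pulseAt u t with _ | k <;> rfl

theorem isDensity_sentAt {ρ₀ : Matrix (Fin d) (Fin d) ℂ} (h : IsDensity ρ₀) (S : Schedule d ℓ)
    (u : Fin ℓ → Fin q) (t : ℕ) : IsDensity (sentAt ρ₀ S u t) := by
  rw [sentAt_eq]
  rcases pulseAt u t with _ | k
  · exact h
  · exact isDensity_sentPulse h S k

end Probes

/-! ### The law of Bob's results -/

section Law

variable {d ℓ q T : ℕ} {Φ : Matrix (Fin d) (Fin d) ℂ →ₗ[ℂ] Matrix (Fin d) (Fin d) ℂ}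

/-- The probability of the result `b` on pulse `k`. -/
def pulseProb (Φ : Matrix (Fin d) (Fin d) ℂ →ₗ[ℂ] Matrix (Fin d) (Fin d) ℂ)
    (ρ₀ : Matrix (Fin d) (Fin d) ℂ) (S : Schedule d ℓ) (k : Fin ℓ) (b : Bool) : ℝ :=
  (testEffect (S.test k) b * Φ (sentPulse ρ₀ S k)).trace.re

/-- The map takes density operators to density operators. -/
def PreservesDensity (Φ : Matrix (Fin d) (Fin d) ℂ →ₗ[ℂ] Matrix (Fin d) (Fin d) ℂ) : Prop :=
  ∀ ρ, IsDensity ρ → IsDensity (Φ ρ)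

theorem pulseProb_nonneg (hΦ : PreservesDensity Φ) {ρ₀ : Matrix (Fin d) (Fin d) ℂ}
    (h₀ : IsDensity ρ₀) (S : Schedule d ℓ) (k : Fin ℓ) (b : Bool) : 0 ≤ pulseProb Φ ρ₀ S k b :=
  (Complex.nonneg_iff.1 (trace_mul_nonneg (posSemidef_testEffect _ _)
    (hΦ _ (isDensity_sentPulse h₀ S k)).1)).1

theorem ofReal_pulseProb (hΦ : PreservesDensity Φ) {ρ₀ : Matrix (Fin d) (Fin d) ℂ}
    (h₀ : IsDensity ρ₀) (S : Schedule d ℓ) (k : Fin ℓ) (b : Bool) :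
    (pulseProb Φ ρ₀ S k b : ℂ) = (testEffect (S.test k) b * Φ (sentPulse ρ₀ S k)).trace := by
  have := Complex.nonneg_iff.1 (trace_mul_nonneg (posSemidef_testEffect (S.test k) b)
    (hΦ _ (isDensity_sentPulse h₀ S k)).1)
  apply Complex.ext
  · simp [pulseProb]
  · simp [← this.2]

theorem sum_pulseProb (hΦ : PreservesDensity Φ) {ρ₀ : Matrix (Fin d) (Fin d) ℂ}
    (h₀ : IsDensity ρ₀) (S : Schedule d ℓ) (k : Fin ℓ) : ∑ b, pulseProb Φ ρ₀ S k b = 1 := by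
  have h : ∑ b, (testEffect (S.test k) b * Φ (sentPulse ρ₀ S k)).trace = 1 := by
    rw [← Matrix.trace_sum, ← Finset.sum_mul, sum_testEffect, one_mul,
      (hΦ _ (isDensity_sentPulse h₀ S k)).2]
  simp only [← ofReal_pulseProb hΦ h₀] at h
  exact_mod_cast h

/-- An idle use carries the trivial effect and contributes trace one. The remaining product over
pulses is the same for every choice of slots, so averaging over slots is trivial and the bits are
independent. -/
theorem prob_eq_sum_prod (hΦ : PreservesDensity Φ) {ρ₀ : Matrix (Fin d) (Fin d) ℂ}
    (h₀ : IsDensity ρ₀) (S : Schedule d ℓ) (hq : 1 ≤ q) (hT : q * ℓ ≤ T) (A : Outcome ℓ → Prop)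
    [DecidablePred A] : prob (q := q) T Φ ρ₀ S A = ∑ j, if A j then ∏ k, pulseProb Φ ρ₀ S k (j k) else 0 := by
  have h : ∀ (u : Fin ℓ → Fin q) (j : Outcome ℓ),
      (tensor (fun t : Fin T => effectAt S u j t) *
        tensor (fun t : Fin T => Φ (sentAt ρ₀ S u t))).trace.re
        = ∏ k, pulseProb Φ ρ₀ S k (j k) := by
    intro u j
    rw [tensor_mul, trace_tensor]
    have : ∀ t : Fin T, (effectAt S u j t * Φ (sentAt ρ₀ S u t)).trace =
        (pulseAt u t).elim 1 (fun k => (pulseProb Φ ρ₀ S k (j k) : ℂ)) := by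
      intro t
      rw [effectAt_eq, sentAt_eq]
      rcases pulseAt u t with _ | k
      · simp [(hΦ _ h₀).2]
      · simp [ofReal_pulseProb hΦ h₀]
    rw [Finset.prod_congr rfl fun t _ => this t, prod_elim_pulseAt hT u, ← Complex.ofReal_prod,
      Complex.ofReal_re]
  unfold prob
  simp only [h, Finset.sum_const, Finset.card_univ, Fintype.card_fun, Fintype.card_fin,
    nsmul_eq_mul]
  push_cast
  have : (0 : ℝ) < q := by exact_mod_cast hq
  rw [inv_mul_cancel_left₀ (by positivity)]

end Law

/-! ### Concentration of product Bernoulli laws -/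

section Concentration

variable {ℓ : ℕ}

/-- Uses `exp y ≤ 1 + y + y²` for `|y| ≤ 1`: the linear terms cancel by centering, the variance `p
(1 - p)` is at most one, and `1 + x² ≤ exp (x²)`. -/
theorem bernoulli_mgf_le {p x : ℝ} (h0 : 0 ≤ p) (h1 : p ≤ 1) (hx : |x| ≤ 1) :
    p * Real.exp (x * (1 - p)) + (1 - p) * Real.exp (x * (0 - p)) ≤ Real.exp (x ^ 2) := by
  have hb : ∀ y : ℝ, |y| ≤ 1 → Real.exp (x * y) ≤ 1 + x * y + (x * y) ^ 2 := by
    intro y hy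
    have hxy : |x * y| ≤ 1 := by
      rw [abs_mul]
      exact mul_le_one₀ hx (abs_nonneg _) hy
    have := (abs_le.1 (Real.abs_exp_sub_one_sub_id_le hxy)).2
    linarith
  have e1 := hb (1 - p) (abs_le.2 ⟨by linarith, by linarith⟩)
  have e2 := hb (0 - p) (abs_le.2 ⟨by linarith, by linarith⟩)
  have e3 := Real.add_one_le_exp (x ^ 2)
  have e4 := mul_le_mul_of_nonneg_left e1 h0
  have e5 := mul_le_mul_of_nonneg_left e2 (sub_nonneg.2 h1)
  have e6 : p * (1 - p) ≤ 1 := by nlinarith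
  nlinarith [mul_le_mul_of_nonneg_left e6 (sq_nonneg x)]

theorem sum_prod_mul_exp_le {P : Fin ℓ → Bool → ℝ} (hP : ∀ k b, 0 ≤ P k b)
    (hP1 : ∀ k, ∑ b, P k b = 1) (K : Finset (Fin ℓ)) {p : ℝ} (hp : ∀ k ∈ K, P k true = p)
    {x : ℝ} (hx : |x| ≤ 1) :
    ∑ j : Outcome ℓ, (∏ k, P k (j k)) *
      Real.exp (x * ∑ k ∈ K, ((if j k = true then 1 else 0) - p)) ≤ Real.exp (K.card * x ^ 2) := by
  have h : ∀ j : Outcome ℓ, (∏ k, P k (j k)) *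
      Real.exp (x * ∑ k ∈ K, ((if j k = true then 1 else 0) - p)) =
      ∏ k, P k (j k) * (if k ∈ K then Real.exp (x * ((if j k = true then 1 else 0) - p)) else 1) := by
    intro j
    rw [Finset.prod_mul_distrib, Finset.mul_sum, Real.exp_sum, Finset.prod_ite_mem,
      Finset.univ_inter]
  have h2 : ∑ j : Outcome ℓ, ∏ k, P k (j k) *
        (if k ∈ K then Real.exp (x * ((if j k = true then 1 else 0) - p)) else 1) =
      ∏ k, ∑ b, P k b *
        (if k ∈ K then Real.exp (x * ((if b = true then 1 else 0) - p)) else 1) := by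
    rw [Finset.prod_univ_sum, Fintype.piFinset_univ]
  rw [Finset.sum_congr rfl fun j _ => h j, h2]
  have h3 : Real.exp (K.card * x ^ 2) = ∏ k : Fin ℓ, if k ∈ K then Real.exp (x ^ 2) else 1 := by
    rw [Finset.prod_ite_mem, Finset.univ_inter, Finset.prod_const, ← Real.exp_nat_mul]
  rw [h3]
  refine Finset.prod_le_prod (fun k _ => Finset.sum_nonneg fun b _ => mul_nonneg (hP k b) ?_) ?_
  · split_ifs <;> positivity
  · intro k _
    by_cases hk : k ∈ K
    · have e := hP1 k
      have e0 := hP k true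
      have e1 := hP k false
      simp only [Fintype.sum_bool] at e
      rw [hp k hk] at e e0
      have e' : P k false = 1 - p := by linarith
      simpa [hk, hp k hk, e'] using bernoulli_mgf_le e0 (by linarith) hx
    · simp only [hk, if_false, mul_one, hP1 k, le_refl]

-- Exponential Markov inequality with parameter `s ε / 2`; the sign `s = ±1` selects the upper or
-- the lower tail. The exponent is `K ε²/4 - K ε²/2`, with `K` the number of tests.
open Classical in
theorem sum_prod_tail_le {P : Fin ℓ → Bool → ℝ} (hP : ∀ k b, 0 ≤ P k b)
    (hP1 : ∀ k, ∑ b, P k b = 1) (K : Finset (Fin ℓ)) {p : ℝ} (hp : ∀ k ∈ K, P k true = p)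
    {s ε : ℝ} (hs : |s| = 1) (hε : 0 ≤ ε) (hε1 : ε ≤ 1) :
    ∑ j : Outcome ℓ, (if K.card * ε ≤ s * ∑ k ∈ K, ((if j k = true then 1 else 0) - p) then
      ∏ k, P k (j k) else 0) ≤ Real.exp (-(K.card * ε ^ 2 / 4)) := by
  have hs2 : s ^ 2 = 1 := by rw [← sq_abs, hs, one_pow]
  have hx : |s * (ε / 2)| ≤ 1 := by
    rw [abs_mul, hs, one_mul, abs_of_nonneg (by linarith)]
    linarith
  have hmain := sum_prod_mul_exp_le hP hP1 K hp hx
  have hle : ∀ j : Outcome ℓ,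
      (if K.card * ε ≤ s * ∑ k ∈ K, ((if j k = true then 1 else 0) - p) then
        ∏ k, P k (j k) else 0) ≤ ((∏ k, P k (j k)) *
      Real.exp (s * (ε / 2) * ∑ k ∈ K, ((if j k = true then 1 else 0) - p))) *
        Real.exp (-(K.card * ε ^ 2 / 2)) := by
    intro j
    have hw : 0 ≤ ∏ k, P k (j k) := Finset.prod_nonneg fun k _ => hP k _
    split_ifs with h
    · rw [mul_assoc, ← Real.exp_add]
      refine le_mul_of_one_le_right hw (Real.one_le_exp ?_)
      have := mul_le_mul_of_nonneg_right h (by linarith : 0 ≤ ε / 2)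
      nlinarith
    · positivity
  refine (Finset.sum_le_sum fun j _ => hle j).trans ?_
  rw [← Finset.sum_mul]
  refine (mul_le_mul_of_nonneg_right hmain (Real.exp_pos _).le).trans ?_
  rw [← Real.exp_add, Real.exp_le_exp, mul_pow, hs2]
  apply le_of_eq
  ring

end Concentration

/-! ### Concentration of the empirical frequencies -/

section Frequencies

variable {d ℓ q T : ℕ} {Φ : Matrix (Fin d) (Fin d) ℂ →ₗ[ℂ] Matrix (Fin d) (Fin d) ℂ}
  {ρ₀ : Matrix (Fin d) (Fin d) ℂ} {S : Schedule d ℓ}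

/-- The probability of the result `t` in the test of `t` on the output for the probe `s`. -/
def probeProb (Φ : Matrix (Fin d) (Fin d) ℂ →ₗ[ℂ] Matrix (Fin d) (Fin d) ℂ) (s t : Label d) : ℝ :=
  (probe t * Φ (probe s)).trace.re

/-- The frequencies are uniformly within `ε` of the probabilities. -/
def FreqClose (Φ : Matrix (Fin d) (Fin d) ℂ →ₗ[ℂ] Matrix (Fin d) (Fin d) ℂ) (S : Schedule d ℓ)
    (ε : ℝ) (j : Outcome ℓ) : Prop :=
  ∀ s t, |freq S j s t - probeProb Φ s t| ≤ ε

theorem prob_mono (hΦ : PreservesDensity Φ) (h₀ : IsDensity ρ₀) (hq : 1 ≤ q) (hT : q * ℓ ≤ T)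
    {A B : Outcome ℓ → Prop} (h : ∀ j, A j → B j) :
    prob (q := q) T Φ ρ₀ S A ≤ prob (q := q) T Φ ρ₀ S B := by
  classical
  rw [prob_eq_sum_prod hΦ h₀ S hq hT, prob_eq_sum_prod hΦ h₀ S hq hT]
  refine Finset.sum_le_sum fun j _ => ?_
  have hw : 0 ≤ ∏ k, pulseProb Φ ρ₀ S k (j k) :=
    Finset.prod_nonneg fun k _ => pulseProb_nonneg hΦ h₀ S k _
  by_cases hA : A j
  · simp [hA, h j hA]
  · by_cases hB : B j <;> simp [hA, hB, hw]

theorem prob_add_prob_not (hΦ : PreservesDensity Φ) (h₀ : IsDensity ρ₀) (hq : 1 ≤ q)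
    (hT : q * ℓ ≤ T) (A : Outcome ℓ → Prop) :
    prob (q := q) T Φ ρ₀ S A + prob (q := q) T Φ ρ₀ S (fun j => ¬ A j) = 1 := by
  classical
  rw [prob_eq_sum_prod hΦ h₀ S hq hT, prob_eq_sum_prod hΦ h₀ S hq hT, ← Finset.sum_add_distrib]
  have : ∀ j : Outcome ℓ, ((if A j then ∏ k, pulseProb Φ ρ₀ S k (j k) else 0) +
      if ¬ A j then ∏ k, pulseProb Φ ρ₀ S k (j k) else 0) = ∏ k, pulseProb Φ ρ₀ S k (j k) := by
    intro j
    by_cases h : A j <;> simp [h]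
  rw [Finset.sum_congr rfl fun j _ => this j]
  have := Finset.prod_univ_sum (fun _ : Fin ℓ => (Finset.univ : Finset Bool))
    (fun k b => pulseProb Φ ρ₀ S k b)
  rw [Fintype.piFinset_univ] at this
  rw [← this]
  simp only [sum_pulseProb hΦ h₀ S, Finset.prod_const_one]

/-- Union bound over all pairs of sent and tested states and over the two tails. -/
theorem prob_not_freqClose_le (hΦ : PreservesDensity Φ) (h₀ : IsDensity ρ₀) (hq : 1 ≤ q)
    (hT : q * ℓ ≤ T) {ε : ℝ} (hε : 0 < ε) (hε1 : ε ≤ 1) :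
    prob (q := q) T Φ ρ₀ S (fun j => ¬ FreqClose Φ S ε j) ≤
      (Fintype.card (Label d) : ℝ) ^ 2 * (2 * Real.exp (-(reps d ℓ * ε ^ 2 / 4))) := by
  classical
  rw [prob_eq_sum_prod hΦ h₀ S hq hT]
  set w : Outcome ℓ → ℝ := fun j => ∏ k, pulseProb Φ ρ₀ S k (j k)
  set K : Label d → Label d → Finset (Fin ℓ) := fun s t =>
    Finset.univ.filter fun k => S.prep k = some s ∧ S.test k = some t
  have hK : ∀ s t, (K s t).card = reps d ℓ := S.card_test
  have hw : ∀ j, 0 ≤ w j := fun j => Finset.prod_nonneg fun k _ => pulseProb_nonneg hΦ h₀ S k _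
  set Z : Label d → Label d → Outcome ℓ → ℝ := fun s t j =>
    ∑ k ∈ K s t, ((if j k = true then 1 else 0) - probeProb Φ s t)
  have hp : ∀ s t, ∀ k ∈ K s t, pulseProb Φ ρ₀ S k true = probeProb Φ s t := by
    intro s t k hk
    obtain ⟨h1, h2⟩ := (Finset.mem_filter.1 hk).2
    simp [pulseProb, probeProb, sentPulse, testEffect, h1, h2]
  have htail : ∀ s t (σ : ℝ), |σ| = 1 →
      ∑ j : Outcome ℓ, (if reps d ℓ * ε ≤ σ * Z s t j then w j else 0) ≤
        Real.exp (-(reps d ℓ * ε ^ 2 / 4)) := by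
    intro s t σ hσ
    have := sum_prod_tail_le (fun k b => pulseProb_nonneg hΦ h₀ S k b)
      (fun k => sum_pulseProb hΦ h₀ S k) (K s t) (hp s t) hσ hε.le hε1
    rwa [hK] at this
  have hZ : ∀ s t j, Z s t j = reps d ℓ * (freq S j s t - probeProb Φ s t) := by
    intro s t j
    have h1 : ∑ k ∈ K s t, (if j k = true then (1 : ℝ) else 0) =
        ((Finset.univ.filter fun k => S.prep k = some s ∧ S.test k = some t ∧ j k = true).card : ℝ) := by
      rw [Finset.sum_boole, Finset.filter_filter]
      congr 3
      ext k
      simp [and_assoc]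
    simp only [Z]
    rw [Finset.sum_sub_distrib, h1, Finset.sum_const, hK, nsmul_eq_mul, mul_sub, freq]
    congr 1
    -- Without repetitions the frequency is `0 / 0 = 0`; the count vanishes too, so the identity
    -- survives.
    rcases Nat.eq_zero_or_pos (reps d ℓ) with h0 | h0
    · have : (Finset.univ.filter fun k => S.prep k = some s ∧ S.test k = some t ∧ j k = true).card
          ≤ (K s t).card := Finset.card_le_card fun k hk => by
        simp only [K, Finset.mem_filter, Finset.mem_univ, true_and] at hk ⊢
        exact ⟨hk.1, hk.2.1⟩
      rw [hK, h0] at this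
      rw [Nat.le_zero.1 this, h0]
      simp
    · have : (reps d ℓ : ℝ) ≠ 0 := by exact_mod_cast h0.ne'
      field_simp
  have hle : ∀ j, (if ¬ FreqClose Φ S ε j then w j else 0) ≤
      ∑ s, ∑ t, ((if reps d ℓ * ε ≤ 1 * Z s t j then w j else 0) +
        (if reps d ℓ * ε ≤ (-1) * Z s t j then w j else 0)) := by
    intro j
    have hn : ∀ s t, 0 ≤ (if reps d ℓ * ε ≤ 1 * Z s t j then w j else 0) +
        (if reps d ℓ * ε ≤ (-1) * Z s t j then w j else 0) := by
      intro s t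
      have := hw j
      split_ifs <;> simp [this]
    by_cases h : FreqClose Φ S ε j
    · rw [if_neg (not_not.2 h)]
      exact Finset.sum_nonneg fun s _ => Finset.sum_nonneg fun t _ => hn s t
    · rw [if_pos h]
      simp only [FreqClose, not_forall, not_le] at h
      obtain ⟨s, t, hst⟩ := h
      have h1 : w j ≤ (if reps d ℓ * ε ≤ 1 * Z s t j then w j else 0) +
          (if reps d ℓ * ε ≤ (-1) * Z s t j then w j else 0) := by
        have hr : (0 : ℝ) ≤ reps d ℓ := Nat.cast_nonneg _
        have := hw j
        rcases lt_abs.1 hst with h | h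
        · rw [if_pos]
          · split_ifs <;> linarith
          · rw [hZ, one_mul]
            exact mul_le_mul_of_nonneg_left h.le hr
        · rw [add_comm, if_pos]
          · split_ifs <;> linarith
          · rw [hZ, neg_one_mul, ← mul_neg]
            exact mul_le_mul_of_nonneg_left h.le hr
      refine h1.trans ((Finset.single_le_sum (f := fun t =>
        (if reps d ℓ * ε ≤ 1 * Z s t j then w j else 0) +
          (if reps d ℓ * ε ≤ (-1) * Z s t j then w j else 0))
        (fun t _ => hn s t) (Finset.mem_univ t)).trans ?_)
      exact Finset.single_le_sum (f := fun s => ∑ t,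
        ((if reps d ℓ * ε ≤ 1 * Z s t j then w j else 0) +
          (if reps d ℓ * ε ≤ (-1) * Z s t j then w j else 0)))
        (fun s _ => Finset.sum_nonneg fun t _ => hn s t) (Finset.mem_univ s)
  refine (Finset.sum_le_sum fun j _ => hle j).trans ?_
  rw [Finset.sum_comm]
  have : ∀ s, ∑ j : Outcome ℓ, ∑ t, ((if reps d ℓ * ε ≤ 1 * Z s t j then w j else 0) +
        (if reps d ℓ * ε ≤ (-1) * Z s t j then w j else 0)) ≤
      ∑ t : Label d, 2 * Real.exp (-(reps d ℓ * ε ^ 2 / 4)) := by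
    intro s
    rw [Finset.sum_comm]
    refine Finset.sum_le_sum fun t _ => ?_
    rw [Finset.sum_add_distrib]
    have h1 := htail s t 1 (by simp)
    have h2 := htail s t (-1) (by simp)
    linarith
  refine (Finset.sum_le_sum fun s _ => this s).trans (le_of_eq ?_)
  simp only [Finset.sum_const, Finset.card_univ, nsmul_eq_mul]
  ring

/-- Half of the decay rate absorbs the number of pairs and the rounding in `reps`; the other half
gives `ξ`. -/
theorem exists_exponent (hd : 0 < d) {ε : ℝ} (hε : 0 < ε) :
    ∃ ξ : ℝ, 0 < ξ ∧ ∃ ℓ₀ : ℕ, ∀ ℓ, ℓ₀ ≤ ℓ →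
      (Fintype.card (Label d) : ℝ) ^ 2 * (2 * Real.exp (-(reps d ℓ * ε ^ 2 / 4))) ≤
        (2 : ℝ) ^ (-(ξ * ℓ)) := by
  have hN : 0 < Fintype.card (Label d) := Fintype.card_pos_iff.2 ⟨.inl ⟨0, hd⟩⟩
  set N := Fintype.card (Label d)
  have hNR : (0 : ℝ) < N := by exact_mod_cast hN
  have hl2 : 0 < Real.log 2 := Real.log_pos one_lt_two
  -- Half of the true rate `ε² / (4 N²)` per pulse. Division by `log 2` below changes to base two.
  set a : ℝ := ε ^ 2 / (8 * N ^ 2)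
  have ha : 0 < a := by positivity
  -- From this `ℓ₀` on, `exp (a ℓ) ≥ a ℓ` dominates the prefactor, which contains `exp (ε² / 4)` for
  -- the lost repetition.
  obtain ⟨ℓ₀, hℓ₀⟩ := exists_nat_ge ((N : ℝ) ^ 2 * (2 * Real.exp (ε ^ 2 / 4)) / a)
  refine ⟨a / Real.log 2, by positivity, ℓ₀, fun ℓ hℓ => ?_⟩
  have hr : (ℓ : ℝ) / N ^ 2 - 1 ≤ reps d ℓ := by
    have h1 : ℓ < N * N * (reps d ℓ + 1) := by
      rw [reps, Nat.div_div_eq_div_mul]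
      exact Nat.lt_mul_div_succ ℓ (Nat.mul_pos hN hN)
    have h2 : (ℓ : ℝ) < N * N * (reps d ℓ + 1) := by exact_mod_cast h1
    rw [sub_le_iff_le_add, div_le_iff₀ (by positivity)]
    nlinarith
  have h3 : (N : ℝ) ^ 2 * (2 * Real.exp (ε ^ 2 / 4)) ≤ Real.exp (a * ℓ) := by
    have h4 : (N : ℝ) ^ 2 * (2 * Real.exp (ε ^ 2 / 4)) ≤ ℓ * a := by
      rw [← div_le_iff₀ ha]
      exact hℓ₀.trans (by exact_mod_cast hℓ)
    have := Real.add_one_le_exp (a * ℓ)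
    linarith
  have h5 : (2 : ℝ) ^ (-(a / Real.log 2 * ℓ)) = Real.exp (-(a * ℓ)) := by
    rw [Real.rpow_def_of_pos two_pos]
    congr 1
    field_simp
  have h6 : Real.exp (-(reps d ℓ * ε ^ 2 / 4)) ≤
      Real.exp (ε ^ 2 / 4) * Real.exp (-(a * ℓ)) * Real.exp (-(a * ℓ)) := by
    rw [← Real.exp_add, ← Real.exp_add, Real.exp_le_exp]
    have := mul_le_mul_of_nonneg_right hr (by positivity : 0 ≤ ε ^ 2 / 4)
    have h7 : (ℓ : ℝ) / N ^ 2 * (ε ^ 2 / 4) = 2 * (a * ℓ) := by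
      simp only [a]
      field_simp
      ring
    nlinarith
  rw [h5]
  have h8 : Real.exp (a * ℓ) * Real.exp (-(a * ℓ)) = 1 := by rw [← Real.exp_add]; simp
  have hp := Real.exp_pos (-(a * ℓ))
  calc (N : ℝ) ^ 2 * (2 * Real.exp (-(reps d ℓ * ε ^ 2 / 4)))
      ≤ N ^ 2 * (2 * (Real.exp (ε ^ 2 / 4) * Real.exp (-(a * ℓ)) * Real.exp (-(a * ℓ)))) := by
        gcongr
    _ = (N ^ 2 * (2 * Real.exp (ε ^ 2 / 4))) * Real.exp (-(a * ℓ)) * Real.exp (-(a * ℓ)) := by ring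
    _ ≤ Real.exp (a * ℓ) * Real.exp (-(a * ℓ)) * Real.exp (-(a * ℓ)) := by gcongr
    _ = Real.exp (-(a * ℓ)) := by rw [h8, one_mul]

end Frequencies

/-! ### Partial traces and complementary channels -/

section PartialTrace

variable {d e : ℕ}

theorem traceE_eq_sum (X : Matrix (Fin d × Fin e) (Fin d × Fin e) ℂ) :
    traceE X = ∑ a, X.submatrix (fun i => (i, a)) (fun i => (i, a)) := by
  ext i j
  simp [traceE, Matrix.sum_apply]

theorem traceB_eq_sum (X : Matrix (Fin d × Fin e) (Fin d × Fin e) ℂ) :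
    traceB X = ∑ i, X.submatrix (fun a => (i, a)) (fun a => (i, a)) := by
  ext i j
  simp [traceB, Matrix.sum_apply]

theorem posSemidef_traceE {X : Matrix (Fin d × Fin e) (Fin d × Fin e) ℂ} (h : X.PosSemidef) :
    (traceE X).PosSemidef := by
  rw [traceE_eq_sum]
  exact Matrix.posSemidef_sum _ fun a _ => h.submatrix _

theorem posSemidef_traceB {X : Matrix (Fin d × Fin e) (Fin d × Fin e) ℂ} (h : X.PosSemidef) :
    (traceB X).PosSemidef := by
  rw [traceB_eq_sum]
  exact Matrix.posSemidef_sum _ fun a _ => h.submatrix _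

theorem trace_traceE (X : Matrix (Fin d × Fin e) (Fin d × Fin e) ℂ) :
    (traceE X).trace = X.trace := by
  simp [traceE, Matrix.trace, Fintype.sum_prod_type]

theorem trace_traceB (X : Matrix (Fin d × Fin e) (Fin d × Fin e) ℂ) :
    (traceB X).trace = X.trace := by
  simp only [traceB, Matrix.trace, Fintype.sum_prod_type, Matrix.diag_apply, Matrix.of_apply]
  exact Finset.sum_comm

theorem isDensity_isometry {m n : Type*} [Fintype m] [Fintype n] [DecidableEq m] [DecidableEq n]
    {V : Matrix m n ℂ} (hV : Vᴴ * V = 1) {ρ : Matrix n n ℂ} (h : IsDensity ρ) :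
    IsDensity (V * ρ * Vᴴ) := by
  refine ⟨h.1.mul_mul_conjTranspose_same V, ?_⟩
  rw [Matrix.mul_assoc, Matrix.trace_mul_comm, Matrix.mul_assoc, hV, Matrix.mul_one, h.2]

theorem isDensity_complement {V : Matrix (Fin d × Fin e) (Fin d) ℂ} (hV : Vᴴ * V = 1)
    {ρ : Matrix (Fin d) (Fin d) ℂ} (h : IsDensity ρ) : IsDensity (complement V ρ) := by
  have := isDensity_isometry hV h
  exact ⟨posSemidef_traceB this.1, by rw [complement, trace_traceB, this.2]⟩

theorem IsIsometricExtension.preservesDensity {V : Matrix (Fin d × Fin e) (Fin d) ℂ}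
    {Φ : Matrix (Fin d) (Fin d) ℂ →ₗ[ℂ] Matrix (Fin d) (Fin d) ℂ}
    (h : IsIsometricExtension V Φ) : PreservesDensity Φ := by
  intro ρ hρ
  have := isDensity_isometry h.1 hρ
  rw [h.2]
  exact ⟨posSemidef_traceE this.1, by rw [trace_traceE, this.2]⟩

theorem traceB_sum {ι : Type*} (s : Finset ι)
    (X : ι → Matrix (Fin d × Fin e) (Fin d × Fin e) ℂ) :
    traceB (∑ i ∈ s, X i) = ∑ i ∈ s, traceB (X i) := by
  ext a b
  simp only [traceB, Matrix.sum_apply, Matrix.of_apply]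
  exact Finset.sum_comm

theorem IsDensity.nonempty {n : Type*} [Fintype n] {ρ : Matrix n n ℂ} (h : IsDensity ρ) :
    Nonempty n := by
  by_contra hn
  rw [not_nonempty_iff] at hn
  have := h.2
  simp [Matrix.trace] at this

end PartialTrace

/-! ### Kronecker sums and the one-time pad -/

theorem sum_kronecker {ι m n : Type*} (s : Finset ι) (A : ι → Matrix m m ℂ) (B : Matrix n n ℂ) :
    (∑ i ∈ s, A i) ⊗ₖ B = ∑ i ∈ s, A i ⊗ₖ B := by
  ext a b
  simp [Matrix.sum_apply, Finset.sum_mul]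

theorem kronecker_sum {ι m n : Type*} (s : Finset ι) (A : Matrix m m ℂ) (B : ι → Matrix n n ℂ) :
    A ⊗ₖ (∑ i ∈ s, B i) = ∑ i ∈ s, A ⊗ₖ B i := by
  ext a b
  simp [Matrix.sum_apply, Finset.mul_sum]

/-- Perfect secrecy of the pad: translation by `a` permutes the keys, so the sum forgets `a`. -/
theorem sum_single_add {G : Type*} [AddGroup G] [Fintype G] [DecidableEq G] (a : G) :
    ∑ k : G, Matrix.single (a + k) (a + k) (1 : ℂ) = 1 := by
  rw [← Matrix.sum_single_one]
  exact Equiv.sum_comp (Equiv.addLeft a) fun k => Matrix.single k k (1 : ℂ)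

theorem posDef_uniformW (b : ℕ) : (uniformW b).PosDef := by
  rw [uniformW]
  exact Matrix.PosDef.one.smul (by positivity)

theorem isDensity_uniformW (b : ℕ) : IsDensity (uniformW b) := by
  refine ⟨(posDef_uniformW b).posSemidef, ?_⟩
  simp [uniformW, Matrix.trace_smul, ZMod.card]

/-! ### Covertness -/

section Covert

variable {d e ℓ q T b : ℕ} {V : Matrix (Fin d × Fin e) (Fin d) ℂ} {ρ₀ : Matrix (Fin d) (Fin d) ℂ}
  {S : Schedule d ℓ}

/-- No signalling: each test's effects sum to the identity and the outcome of each pulse enters one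
factor only, so forgetting Bob's results leaves Eve's marginal untouched. -/
theorem sum_tensor_outcomes (hT : q * ℓ ≤ T) (S : Schedule d ℓ) (u : Fin ℓ → Fin q)
    (X : Fin T → Matrix (Fin d × Fin e) (Fin d × Fin e) ℂ) :
    ∑ j : Outcome ℓ, tensor (fun t : Fin T =>
      traceB ((effectAt S u j t ⊗ₖ (1 : Matrix (Fin e) (Fin e) ℂ)) * X t)) =
      tensor fun t => traceB (X t) := by
  ext a a'
  simp only [Matrix.sum_apply, tensor, Matrix.of_apply]
  have h : ∀ (j : Outcome ℓ) (t : Fin T),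
      traceB ((effectAt S u j t ⊗ₖ (1 : Matrix (Fin e) (Fin e) ℂ)) * X t) (a t) (a' t) =
      (pulseAt u t).elim (traceB (X t) (a t) (a' t)) (fun k =>
        traceB ((testEffect (S.test k) (j k) ⊗ₖ (1 : Matrix (Fin e) (Fin e) ℂ)) * X t)
          (a t) (a' t)) := by
    intro j t
    rw [effectAt_eq]
    rcases pulseAt u t with _ | k
    · simp
    · rfl
  simp only [h]
  rw [sum_prod_pulseAt hT u (fun t => traceB (X t) (a t) (a' t)) fun t k b =>
    traceB ((testEffect (S.test k) b ⊗ₖ (1 : Matrix (Fin e) (Fin e) ℂ)) * X t) (a t) (a' t)]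
  refine Finset.prod_congr rfl fun t _ => ?_
  rcases pulseAt u t with _ | k
  · rfl
  · simp only [Option.elim_some]
    rw [← Matrix.sum_apply, ← traceB_sum, ← Finset.sum_mul, ← sum_kronecker, sum_testEffect,
      Matrix.one_kronecker_one, one_mul]

/-- The state of Eve's outputs, averaged over the slots. -/
def stateE (T q : ℕ) (V : Matrix (Fin d × Fin e) (Fin d) ℂ) (ρ₀ : Matrix (Fin d) (Fin d) ℂ)
    (S : Schedule d ℓ) : Matrix (Fin T → Fin e) (Fin T → Fin e) ℂ :=
  ((q : ℂ) ^ ℓ)⁻¹ • ∑ u : Fin ℓ → Fin q, tensor fun t : Fin T => complement V (sentAt ρ₀ S u t)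

/-- The key is summed first, while `j` is fixed: this removes `g j`, whatever the encoding, and lets
the sum over results act on Eve's factor alone. -/
theorem stateEW_eq (hT : q * ℓ ≤ T) (g : Outcome ℓ → (Fin b → ZMod 2)) :
    stateEW (q := q) T V ρ₀ S g = stateE T q V ρ₀ S ⊗ₖ uniformW b := by
  rw [stateEW, stateE, uniformW, Matrix.smul_kronecker, Matrix.kronecker_smul, sum_kronecker]
  congr 2
  refine Finset.sum_congr rfl fun u _ => ?_
  rw [Finset.sum_comm]
  simp only [← kronecker_sum, sum_single_add]
  rw [← sum_kronecker, sum_tensor_outcomes hT S u fun t => V * sentAt ρ₀ S u t * Vᴴ]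
  rfl

theorem isDensity_tensor {n : ℕ} {X : Fin T → Matrix (Fin n) (Fin n) ℂ}
    (h : ∀ t, IsDensity (X t)) : IsDensity (tensor X) := by
  refine ⟨posSemidef_tensor fun t => (h t).1, ?_⟩
  rw [trace_tensor, Finset.prod_eq_one fun t _ => (h t).2]

theorem isDensity_stateE (hq : 1 ≤ q) (hV : Vᴴ * V = 1) (h₀ : IsDensity ρ₀) :
    IsDensity (stateE T q V ρ₀ S) := by
  have h : ∀ u : Fin ℓ → Fin q, IsDensity (tensor fun t : Fin T => complement V (sentAt ρ₀ S u t)) :=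
    fun u => isDensity_tensor fun t => isDensity_complement hV (isDensity_sentAt h₀ S u t)
  constructor
  · refine (Matrix.posSemidef_sum _ fun u _ => (h u).1).smul ?_
    positivity
  · rw [stateE, Matrix.trace_smul, Matrix.trace_sum, Finset.sum_congr rfl fun u _ => (h u).2]
    have : (q : ℂ) ≠ 0 := by exact_mod_cast (by omega : q ≠ 0)
    simp [this]

theorem isDensity_kronecker {m n : Type*} [Fintype m] [Fintype n] [DecidableEq m] [DecidableEq n]
    {A : Matrix m m ℂ} {B : Matrix n n ℂ} (hA : IsDensity A) (hB : IsDensity B) :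
    IsDensity (A ⊗ₖ B) :=
  ⟨hA.1.kronecker hB.1, by rw [Matrix.trace_kronecker, hA.2, hB.2, one_mul]⟩

/-- Where at most one of the two slot choices has a pulse, one of the two outputs is the innocent
one, cancels its inverse (cyclically if it stands on the left), and leaves trace one. Only
coincident pulses remain. -/
theorem trace_pair_eq (hT : q * ℓ ≤ T) (hV : Vᴴ * V = 1) (h₀ : IsDensity ρ₀)
    (hσ : (complement V ρ₀).PosDef) (u u' : Fin ℓ → Fin q) :
    ∏ t : Fin T, (complement V (sentAt ρ₀ S u t) * complement V (sentAt ρ₀ S u' t) *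
        (complement V ρ₀)⁻¹).trace =
      ∏ k, if u k = u' k then (complement V (sentPulse ρ₀ S k) * complement V (sentPulse ρ₀ S k) *
        (complement V ρ₀)⁻¹).trace else 1 := by
  have hdet := (Matrix.isUnit_iff_isUnit_det _).1 hσ.isUnit
  set σ := complement V ρ₀
  have hω := fun k => isDensity_complement hV (isDensity_sentPulse h₀ S k)
  have hF : ∀ t : Fin T, (complement V (sentAt ρ₀ S u t) * complement V (sentAt ρ₀ S u' t) *
        σ⁻¹).trace = (pulseAt u t).elim 1 (fun k => if u k = u' k then
          (complement V (sentPulse ρ₀ S k) * complement V (sentPulse ρ₀ S k) * σ⁻¹).trace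
          else 1) := by
    intro t
    rw [sentAt_eq, sentAt_eq]
    rcases hu : pulseAt u t with _ | k
    · have h1 : (complement V ((pulseAt u' t).elim ρ₀ (sentPulse ρ₀ S))).trace = 1 := by
        rcases pulseAt u' t with _ | k'
        · exact (isDensity_complement hV h₀).2
        · exact (hω k').2
      simp only [Option.elim_none]
      rw [Matrix.mul_assoc, Matrix.trace_mul_comm, Matrix.mul_assoc, Matrix.nonsing_inv_mul _ hdet,
        Matrix.mul_one, h1]
    · have hk := (pulseAt_eq_some_iff u t k).1 hu
      simp only [Option.elim_some]
      rcases hu' : pulseAt u' t with _ | k'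
      · have hne : u k ≠ u' k := by
          intro h
          rw [h] at hk
          rw [(pulseAt_eq_some_iff u' t k).2 hk] at hu'
          cases hu'
        simp only [Option.elim_none, if_neg hne]
        rw [Matrix.mul_assoc, Matrix.mul_nonsing_inv _ hdet, Matrix.mul_one, (hω k).2]
      · have hk' := (pulseAt_eq_some_iff u' t k').1 hu'
        have hq : 0 < q := Fin.pos (u k)
        -- Two pulses on the same channel use lie in the same block, whose index is `t / q`.
        have hkk : k = k' := by
          have h1 : (t : ℕ) / q = k := by
            rw [hk, Nat.mul_add_div hq, Nat.div_eq_of_lt (u k).2, add_zero]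
          have h2 : (t : ℕ) / q = k' := by
            rw [hk', Nat.mul_add_div hq, Nat.div_eq_of_lt (u' k').2, add_zero]
          exact Fin.ext (h1.symm.trans h2)
        subst hkk
        have : u k = u' k := Fin.ext (by omega)
        simp only [Option.elim_some, if_pos this]
  rw [Finset.prod_congr rfl fun t _ => hF t]
  exact prod_elim_pulseAt hT u _

/-- For a fixed `u`, the sum over `u'` factorizes over blocks: one slot coincides and `q - 1` do
not, so each block gives `q - 1 + c k`, independently of `u`. -/
theorem trace_stateE_sq (hq : 1 ≤ q) (hT : q * ℓ ≤ T) (hV : Vᴴ * V = 1) (h₀ : IsDensity ρ₀)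
    (hσ : (complement V ρ₀).PosDef) :
    (stateE T q V ρ₀ S * stateE T q V ρ₀ S *
      (tensor (fun _ : Fin T => complement V ρ₀))⁻¹).trace =
      ∏ k, (1 + ((complement V (sentPulse ρ₀ S k) * complement V (sentPulse ρ₀ S k) *
        (complement V ρ₀)⁻¹).trace - 1) / q) := by
  have hq0 : (q : ℂ) ≠ 0 := by exact_mod_cast (by omega : q ≠ 0)
  rw [Matrix.inv_eq_right_inv (tensor_mul_tensor_inv hσ), stateE]
  simp only [Matrix.smul_mul, Matrix.mul_smul, Matrix.trace_smul, Finset.sum_mul, Finset.mul_sum,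
    tensor_mul, Matrix.trace_sum, trace_tensor, trace_pair_eq hT hV h₀ hσ]
  set c : Fin ℓ → ℂ := fun k => (complement V (sentPulse ρ₀ S k) *
    complement V (sentPulse ρ₀ S k) * (complement V ρ₀)⁻¹).trace
  have h1 : ∀ u : Fin ℓ → Fin q, ∑ u' : Fin ℓ → Fin q, ∏ k, (if u' k = u k then c k else 1) =
      ∏ k, (q - 1 + c k) := by
    intro u
    have := Finset.prod_univ_sum (fun _ : Fin ℓ => (Finset.univ : Finset (Fin q)))
      (fun k a => if a = u k then c k else 1)
    rw [Fintype.piFinset_univ] at this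
    rw [← this]
    refine Finset.prod_congr rfl fun k _ => ?_
    rw [← Finset.add_sum_erase _ _ (Finset.mem_univ (u k)), if_pos rfl,
      Finset.sum_congr rfl fun a ha => if_neg (Finset.ne_of_mem_erase ha)]
    simp [Finset.card_erase_of_mem, Nat.cast_sub hq]
    ring
  change ((q : ℂ) ^ ℓ)⁻¹ * ∑ u : Fin ℓ → Fin q, ((q : ℂ) ^ ℓ)⁻¹ * ∑ u' : Fin ℓ → Fin q,
    ∏ k, (if u' k = u k then c k else 1) = ∏ k, (1 + (c k - 1) / q)
  simp only [h1, Finset.sum_const, Finset.card_univ, Fintype.card_fun, Fintype.card_fin,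
    nsmul_eq_mul]
  push_cast
  rw [inv_mul_cancel_left₀ (pow_ne_zero _ hq0)]
  have hpow : (q : ℂ) ^ ℓ = ∏ _k : Fin ℓ, (q : ℂ) := by simp
  rw [hpow, ← Finset.prod_inv_distrib,
    ← Finset.prod_mul_distrib]
  refine Finset.prod_congr rfl fun k _ => ?_
  field_simp
  ring

theorem relEntropy_stateEW_le (hq : 1 ≤ q) (hT : q * ℓ ≤ T) (hV : Vᴴ * V = 1)
    (h₀ : IsDensity ρ₀) {lE : ℝ} (hlE : 0 < lE) (hlE1 : lE ≤ 1)
    (hmin : lE ≤ lambdaMin (complement V ρ₀)) (g : Outcome ℓ → (Fin b → ZMod 2)) :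
    relEntropy (stateEW (q := q) T V ρ₀ S g)
        (tensor (fun _ : Fin T => complement V ρ₀) ⊗ₖ uniformW b)
      ≤ (((ℓ : ℝ) / q * ((e : ℝ) / lE - 1) : ℝ) : EReal) := by
  have hσd := isDensity_complement hV h₀
  have := hσd.nonempty
  have hle := (le_lambdaMin_iff hσd.1.isHermitian lE).1 hmin
  have hσ := posDef_of_algebraMap_le hlE hle
  have hfull : (tensor (fun _ : Fin T => complement V ρ₀) ⊗ₖ uniformW b).PosDef :=
    (posDef_tensor hσ).kronecker (posDef_uniformW b)
  rw [stateEW_eq hT, relEntropy_of_posDef _ hfull, EReal.coe_le_coe_iff]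
  refine (entropyDiff_le_log (isDensity_kronecker (isDensity_stateE hq hV h₀)
    (isDensity_uniformW b)) hfull).trans ?_
  have hU : (uniformW b * uniformW b * (uniformW b)⁻¹).trace = 1 := by
    rw [Matrix.mul_assoc, Matrix.mul_nonsing_inv _
      ((Matrix.isUnit_iff_isUnit_det _).1 (posDef_uniformW b).isUnit), Matrix.mul_one,
      (isDensity_uniformW b).2]
  rw [Matrix.inv_kronecker, ← Matrix.mul_kronecker_mul, ← Matrix.mul_kronecker_mul,
    Matrix.trace_kronecker, hU, mul_one, trace_stateE_sq hq hT hV h₀ hσ]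
  choose r hr hr0 hr1 using fun k => trace_sq_mul_inv_le
    (isDensity_complement hV (isDensity_sentPulse h₀ S k)) hlE hle
  have hqR : (1 : ℝ) ≤ q := by exact_mod_cast hq
  have hprod : (∏ k, (1 + ((complement V (sentPulse ρ₀ S k) * complement V (sentPulse ρ₀ S k) *
        (complement V ρ₀)⁻¹).trace - 1) / q)).re = ∏ k, (1 + (r k - 1) / q) := by
    simp only [hr]
    rw [← Complex.ofReal_re (∏ k, (1 + (r k - 1) / q))]
    push_cast
    rfl
  rw [hprod]
  set y : ℝ := 1 + (lE⁻¹ - 1) / q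
  have hl1 : 1 ≤ lE⁻¹ := one_le_inv₀ hlE |>.2 hlE1
  have hy : 1 ≤ y := le_add_of_nonneg_right (div_nonneg (by linarith) (by linarith))
  have hle1 : ∏ k, (1 + (r k - 1) / q) ≤ y ^ ℓ := by
    have hpow : y ^ ℓ = ∏ _k : Fin ℓ, y := by simp
    rw [hpow]
    refine Finset.prod_le_prod (fun k _ => ?_) (fun k _ => ?_)
    · have : -1 / (q : ℝ) ≤ (r k - 1) / q := by
        gcongr
        linarith [hr0 k]
      have h2 : -1 ≤ -1 / (q : ℝ) := by
        rw [le_div_iff₀ (by linarith)]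
        linarith
      linarith
    · simp only [y]
      gcongr
      exact hr1 k
  -- Monotonicity of `Real.log` needs a positive argument; at zero its default value `0` is still at
  -- most `log (y ^ ℓ)`, because `y ≥ 1`.
  have hnn : 0 ≤ ∏ k, (1 + (r k - 1) / q) → Real.log (∏ k, (1 + (r k - 1) / q)) ≤
      Real.log (y ^ ℓ) := by
    intro h
    rcases h.eq_or_lt with h | h
    · rw [← h, Real.log_zero]
      exact Real.log_nonneg (one_le_pow₀ hy)
    · exact Real.log_le_log h hle1
  have hpos : 0 ≤ ∏ k, (1 + (r k - 1) / q) := by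
    refine Finset.prod_nonneg fun k _ => ?_
    have : 1 + (r k - 1) / q = ((q - 1) + r k) / q := by
      field_simp
      ring
    rw [this]
    exact div_nonneg (by linarith [hr0 k]) (by linarith)
  refine (hnn hpos).trans ?_
  rw [Real.log_pow]
  have h3 := Real.log_le_sub_one_of_pos (by linarith : 0 < y)
  -- Eve's space carries a density, so its dimension is at least one and `1 / lE` may be relaxed to
  -- `e / lE`.
  have he : (1 : ℝ) ≤ e := by
    have : 0 < e := by
      obtain ⟨i⟩ := this
      exact Fin.pos i
    exact_mod_cast this
  have h4 : lE⁻¹ ≤ e / lE := by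
    rw [div_eq_mul_inv]
    exact le_mul_of_one_le_left (by linarith) he
  calc (ℓ : ℝ) * Real.log y ≤ ℓ * (y - 1) := by gcongr
    _ = ℓ / q * (lE⁻¹ - 1) := by
      simp only [y]
      ring
    _ ≤ ℓ / q * (e / lE - 1) := by gcongr

end Covert

/-! ### Tomography -/

section Tomography

variable {d e : ℕ}

theorem trace_probe_mul (t : Label d) (X : Matrix (Fin d) (Fin d) ℂ) :
    (probe t * X).trace = star (probeVec t) ⬝ᵥ (X *ᵥ probeVec t) := by
  rw [probe, Matrix.trace_mul_comm, Matrix.mul_vecMulVec, Matrix.trace_vecMulVec, dotProduct_comm]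

theorem trace_probe_inl (n : Fin d) (X : Matrix (Fin d) (Fin d) ℂ) :
    (probe (.inl n) * X).trace = X n n := by
  rw [trace_probe_mul]
  simp [probeVec]

theorem trace_probe_plus (p : OffDiag d) (X : Matrix (Fin d) (Fin d) ℂ) :
    (probe (.inr (.inl p)) * X).trace =
      (X p.1.1 p.1.1 + X p.1.1 p.1.2 + X p.1.2 p.1.1 + X p.1.2 p.1.2) / 2 := by
  rw [trace_probe_mul]
  simp [probeVec, Matrix.mulVec_add, Matrix.mulVec_smul]
  linear_combination (X p.1.1 p.1.1 + X p.1.1 p.1.2 + X p.1.2 p.1.1 + X p.1.2 p.1.2) *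
    inv_sqrt_two_mul_self

theorem trace_probe_minus (p : OffDiag d) (X : Matrix (Fin d) (Fin d) ℂ) :
    (probe (.inr (.inr p)) * X).trace =
      (X p.1.1 p.1.1 + Complex.I * X p.1.1 p.1.2 - Complex.I * X p.1.2 p.1.1
        + X p.1.2 p.1.2) / 2 := by
  rw [trace_probe_mul]
  simp [probeVec, Matrix.mulVec_add, Matrix.mulVec_smul]
  linear_combination (X p.1.1 p.1.1 + Complex.I * X p.1.1 p.1.2 - Complex.I * X p.1.2 p.1.1
    + X p.1.2 p.1.2) * inv_sqrt_two_mul_self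
    - ((Real.sqrt 2 : ℝ) : ℂ)⁻¹ ^ 2 * X p.1.2 p.1.2 * Complex.I_sq

/-- Polarization: the plus and minus tests reveal both quadratures of the off-diagonal entries once
the diagonal is subtracted. Positivity of `X` makes the traces real, so the real parts lose nothing.
-/
theorem estProbe_trace {X : Matrix (Fin d) (Fin d) ℂ} (hX : X.PosSemidef) :
    estProbe (fun t => (probe t * X).trace.re) = X := by
  have h : ∀ t, (((probe t * X).trace.re : ℝ) : ℂ) = (probe t * X).trace := by
    intro t
    have := Complex.nonneg_iff.1 (trace_mul_nonneg (posSemidef_probe t) hX)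
    apply Complex.ext
    · simp
    · simp [← this.2]
  have h1 := fun n => (h (.inl n)).trans (trace_probe_inl n X)
  have h2 := fun p => (h (.inr (.inl p))).trans (trace_probe_plus p X)
  have h3 := fun p => (h (.inr (.inr p))).trans (trace_probe_minus p X)
  ext n m
  by_cases hnm : n ≠ m
  · simp only [estProbe, Matrix.of_apply, dif_pos hnm, h1, h2, h3]
    linear_combination (X m n - X n m) / 2 * Complex.I_sq
  · obtain rfl : n = m := not_not.1 hnm
    simp only [estProbe, Matrix.of_apply, dif_neg hnm, h1]

theorem probe_apply (s : Label d) (i j : Fin d) :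
    probe s i j = probeVec s i * star (probeVec s j) := rfl

/-- Polarization on the input side. By linearity, the outputs on the probes determine the map on all
matrix units. -/
theorem opBasis_eq_probes (p : OffDiag d) :
    opBasis p.1 = probe (.inr (.inl p)) + Complex.I • probe (.inr (.inr p))
      - ((1 + Complex.I) / 2) • probe (.inl p.1.1) - ((1 + Complex.I) / 2) • probe (.inl p.1.2) := by
  obtain ⟨⟨n, m⟩, h⟩ := p
  ext i j
  simp only [opBasis, Matrix.add_apply, Matrix.sub_apply, Matrix.smul_apply, probe_apply, probeVec,
    Pi.smul_apply, Pi.add_apply, smul_eq_mul, star_mul', star_add, Matrix.single_apply,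
    Pi.single_apply]
  have h2 := inv_sqrt_two_mul_self
  have hs : star (((Real.sqrt 2 : ℝ) : ℂ)⁻¹) = ((Real.sqrt 2 : ℝ) : ℂ)⁻¹ := by simp
  rw [hs]
  set r : ℂ := ((Real.sqrt 2 : ℝ) : ℂ)⁻¹
  simp only [eq_comm (a := n), eq_comm (a := m)]
  have hI := Complex.I_sq
  have hsI : star Complex.I = -Complex.I := Complex.conj_I
  have key : ∀ a b a' b' : ℂ, a * b' = r * (a + b) * (r * (a' + b')) +
      Complex.I * (r * (a + Complex.I * b) * (r * (a' + star Complex.I * b')))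
      - (1 + Complex.I) / 2 * (a * a') - (1 + Complex.I) / 2 * (b * b') := by
    intro a b a' b'
    rw [hsI]
    linear_combination (-((a + b) * (a' + b')) - Complex.I * (a + Complex.I * b) *
      (a' - Complex.I * b')) * h2 + (a * b' / 2 - a' * b / 2 + Complex.I * b * b' / 2) * hI
  have := key (if i = n then 1 else 0) (if i = m then 1 else 0) (if j = n then 1 else 0)
    (if j = m then 1 else 0)
  have e1 : (if i = n ∧ j = m then (1 : ℂ) else 0) =
      (if i = n then 1 else 0) * (if j = m then 1 else 0) := by
    by_cases h1 : i = n <;> by_cases h2 : j = m <;> simp [h1, h2]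
  have e2 : ∀ a : Fin d, star (if j = a then (1 : ℂ) else 0) = if j = a then 1 else 0 := by
    intro a
    split_ifs <;> simp
  rw [e1, e2, e2, this]

theorem estBasis_probeProb {Φ : Matrix (Fin d) (Fin d) ℂ →ₗ[ℂ] Matrix (Fin d) (Fin d) ℂ}
    (hΦ : PreservesDensity Φ) (p : Fin d × Fin d) :
    estBasis (probeProb Φ) p = Φ (opBasis p) := by
  have h : ∀ s, estProbe (probeProb Φ s) = Φ (probe s) := fun s =>
    estProbe_trace (hΦ _ (isDensity_probe s)).1
  unfold estBasis
  split_ifs with hp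
  · have := congrArg Φ (opBasis_eq_probes ⟨p, hp⟩)
    simp only [map_sub, map_add, map_smul] at this
    simp only [h]
    exact this.symm
  · rw [h]
    congr 1
    obtain ⟨n, m⟩ := p
    obtain rfl : n = m := not_not.1 hp
    ext i j
    simp only [opBasis, probe_apply, probeVec, Matrix.single_apply, Pi.single_apply,
      eq_comm (a := n)]
    by_cases h1 : i = n <;> by_cases h2 : j = n <;> simp [h1, h2]

/-- The Kraus operators of an isometry, as the columns of a matrix. -/
def krausMatrix (V : Matrix (Fin d × Fin e) (Fin d) ℂ) : Matrix (Fin d × Fin d) (Fin e) ℂ :=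
  Matrix.of fun j a => V (j.1, a) j.2

theorem chi_eq_krausMatrix {V : Matrix (Fin d × Fin e) (Fin d) ℂ}
    {Φ : Matrix (Fin d) (Fin d) ℂ →ₗ[ℂ] Matrix (Fin d) (Fin d) ℂ}
    (h : IsIsometricExtension V Φ) : chi Φ = krausMatrix V * (krausMatrix V)ᴴ := by
  ext j k
  simp only [chi, chiOfLambda, Matrix.of_apply, h.2, traceE, opBasis, krausMatrix, Matrix.mul_apply,
    Matrix.conjTranspose_apply]
  refine Finset.sum_congr rfl fun a _ => ?_
  rw [Finset.sum_eq_single k.2, Finset.sum_eq_single j.2]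
  · simp
  · intro b _ hb
    simp [hb.symm]
  · simp
  · intro b _ hb
    simp [hb.symm]
  · simp

theorem posSemidef_chi {V : Matrix (Fin d × Fin e) (Fin d) ℂ}
    {Φ : Matrix (Fin d) (Fin d) ℂ →ₗ[ℂ] Matrix (Fin d) (Fin d) ℂ}
    (h : IsIsometricExtension V Φ) : (chi Φ).PosSemidef := by
  rw [chi_eq_krausMatrix h]
  exact Matrix.posSemidef_self_mul_conjTranspose _

/-- This is `tr V†V`. With positivity it bounds the spectrum of `χ` by `d`, uniformly over channels,
as compactness requires. -/
theorem trace_chi {V : Matrix (Fin d × Fin e) (Fin d) ℂ}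
    {Φ : Matrix (Fin d) (Fin d) ℂ →ₗ[ℂ] Matrix (Fin d) (Fin d) ℂ}
    (h : IsIsometricExtension V Φ) : (chi Φ).trace = d := by
  have h1 : (Vᴴ * V).trace = (1 : Matrix (Fin d) (Fin d) ℂ).trace := by rw [h.1]
  rw [chi_eq_krausMatrix h, Matrix.trace_mul_comm]
  simp only [Matrix.trace, Matrix.diag_apply, Matrix.mul_apply, Matrix.conjTranspose_apply,
    krausMatrix, Matrix.of_apply, Fintype.sum_prod_type, Matrix.one_apply, if_true] at h1 ⊢
  rw [Finset.sum_congr rfl fun a _ => Finset.sum_comm, Finset.sum_comm,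
    Finset.sum_congr rfl fun a _ => Finset.sum_comm, h1]
  simp

/-- Here `χ = K K†` while the complement is `Kᵀ (1 ⊗ ρ) K̄`; this is the source of the entrywise
conjugation in `complementOfChi`. -/
theorem complement_eq_krausMatrix (V : Matrix (Fin d × Fin e) (Fin d) ℂ)
    (ρ : Matrix (Fin d) (Fin d) ℂ) : complement V ρ =
      (krausMatrix V)ᵀ * ((1 : Matrix (Fin d) (Fin d) ℂ) ⊗ₖ ρ) * (krausMatrix V).map star := by
  ext a b
  simp only [complement, traceB, Matrix.of_apply, Matrix.mul_apply, Matrix.transpose_apply,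
    krausMatrix, Matrix.kroneckerMap_apply, Matrix.one_apply, Fintype.sum_prod_type,
    Matrix.conjTranspose_apply, Matrix.map_apply]
  refine Finset.sum_congr rfl fun i _ => Finset.sum_congr rfl fun m _ => ?_
  congr 1
  symm
  rw [Finset.sum_eq_single i]
  · simp
  · intro i' _ hi'
    simp [hi']
  · simp

theorem of_trace_opBasis (ρ : Matrix (Fin d) (Fin d) ℂ) :
    (Matrix.of fun j k : Fin d × Fin d => (opBasis j * ρ * (opBasis k)ᴴ).trace) =
      (1 : Matrix (Fin d) (Fin d) ℂ) ⊗ₖ ρ := by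
  ext j k
  simp only [Matrix.of_apply, opBasis, Matrix.conjTranspose_single, star_one,
    Matrix.kroneckerMap_apply, Matrix.one_apply]
  rw [Matrix.mul_assoc, Matrix.trace_single_mul, one_smul]
  by_cases h : j.1 = k.1
  · rw [h, Matrix.mul_single_apply_same]
    simp
  · rw [Matrix.mul_single_apply_of_ne _ _ _ _ _ h]
    simp [h]

theorem chiHat_probeProb {V : Matrix (Fin d × Fin e) (Fin d) ℂ}
    {Φ : Matrix (Fin d) (Fin d) ℂ →ₗ[ℂ] Matrix (Fin d) (Fin d) ℂ}
    (h : IsIsometricExtension V Φ) : chiHat (probeProb Φ) = chi Φ := by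
  have h1 : chiOfLambda (fun j k => estBasis (probeProb Φ) j k.1 k.2) = chi Φ := by
    simp only [estBasis_probeProb h.preservesDensity]
    rfl
  rw [chiHat, h1, (posSemidef_chi h).isHermitian.eq, ← two_smul ℂ, smul_smul]
  norm_num

theorem isHermitian_chiHat (f : Label d → Label d → ℝ) : (chiHat f).IsHermitian := by
  rw [chiHat, Matrix.IsHermitian, Matrix.conjTranspose_smul, Matrix.conjTranspose_add,
    Matrix.conjTranspose_conjTranspose, add_comm]
  simp

theorem estProbe_sub (f g : Label d → ℝ) :
    estProbe f - estProbe g = estProbe fun t => f t - g t := by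
  ext n m
  by_cases h : n ≠ m
  · simp only [estProbe, Matrix.sub_apply, Matrix.of_apply, dif_pos h, Complex.ofReal_sub]
    ring
  · simp only [estProbe, Matrix.sub_apply, Matrix.of_apply, dif_neg h, Complex.ofReal_sub]

theorem estBasis_sub (f g : Label d → Label d → ℝ) (p : Fin d × Fin d) :
    estBasis f p - estBasis g p = estBasis (fun s t => f s t - g s t) p := by
  unfold estBasis
  split_ifs with h
  · simp only [← estProbe_sub, smul_sub]
    abel
  · simp only [← estProbe_sub]

/-- Both polarization formulas are combinations of four terms with coefficients of modulus at most
one. Applied to output and input in turn, this gives the error factor `16`. -/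
theorem norm_combination_le {a b c e z w v : ℂ} {δ : ℝ} (ha : ‖a‖ ≤ δ) (hb : ‖b‖ ≤ δ)
    (hc : ‖c‖ ≤ δ) (he : ‖e‖ ≤ δ) (hz : ‖z‖ ≤ 1) (hw : ‖w‖ ≤ 1) (hv : ‖v‖ ≤ 1) :
    ‖a + z * b - w * c - v * e‖ ≤ 4 * δ := by
  have hm : ∀ x y : ℂ, ‖x‖ ≤ 1 → ‖y‖ ≤ δ → ‖x * y‖ ≤ δ := by
    intro x y hx hy
    rw [norm_mul]
    exact (mul_le_of_le_one_left (norm_nonneg _) hx).trans hy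
  have h1 := norm_sub_le (a + z * b - w * c) (v * e)
  have h2 := norm_sub_le (a + z * b) (w * c)
  have h3 := norm_add_le a (z * b)
  linarith [hm z b hz hb, hm w c hw hc, hm v e hv he]

theorem norm_one_sub_I_div_two_le : ‖(1 - Complex.I) / 2‖ ≤ 1 := by
  rw [norm_div, div_le_one (by simp)]
  refine (norm_sub_le _ _).trans ?_
  simp
  norm_num

theorem norm_one_add_I_div_two_le : ‖(1 + Complex.I) / 2‖ ≤ 1 := by
  rw [norm_div, div_le_one (by simp)]
  refine (norm_add_le _ _).trans ?_
  simp
  norm_num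

theorem norm_estProbe_le {f : Label d → ℝ} {ε : ℝ} (hf : ∀ t, |f t| ≤ ε) (n m : Fin d) :
    ‖estProbe f n m‖ ≤ 4 * ε := by
  have hn : ∀ t, ‖(f t : ℂ)‖ ≤ ε := fun t => by rw [Complex.norm_real]; exact hf t
  by_cases h : n ≠ m
  · simp only [estProbe, Matrix.of_apply, dif_pos h]
    rw [sub_eq_add_neg (f _ : ℂ), ← neg_mul]
    exact norm_combination_le (hn _) (hn _) (hn _) (hn _) (by simp) norm_one_sub_I_div_two_le
      norm_one_sub_I_div_two_le
  · simp only [estProbe, Matrix.of_apply, dif_neg h]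
    have := hn (.inl n)
    have := norm_nonneg (f (.inl n) : ℂ)
    linarith

theorem norm_estBasis_le {f : Label d → Label d → ℝ} {ε : ℝ} (hf : ∀ s t, |f s t| ≤ ε)
    (p : Fin d × Fin d) (n m : Fin d) : ‖estBasis f p n m‖ ≤ 4 * (4 * ε) := by
  have hn := fun s => norm_estProbe_le (hf s) n m
  unfold estBasis
  split_ifs with h
  · simp only [Matrix.sub_apply, Matrix.add_apply, Matrix.smul_apply, smul_eq_mul]
    exact norm_combination_le (hn _) (hn _) (hn _) (hn _) (by simp) norm_one_add_I_div_two_le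
      norm_one_add_I_div_two_le
  · have h1 := hn (.inl p.1)
    have := norm_nonneg (estProbe (f (.inl p.1)) n m)
    linarith

theorem norm_chiHat_sub_le {f g : Label d → Label d → ℝ} {ε : ℝ}
    (hf : ∀ s t, |f s t - g s t| ≤ ε) (j k : Fin d × Fin d) :
    ‖chiHat f j k - chiHat g j k‖ ≤ 16 * ε := by
  have hn := fun p n m => norm_estBasis_le hf p n m
  have h : chiHat f j k - chiHat g j k =
      (1 / 2) * (estBasis (fun s t => f s t - g s t) (j.2, k.2) j.1 k.1 +
        star (estBasis (fun s t => f s t - g s t) (k.2, j.2) k.1 j.1)) := by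
    rw [← estBasis_sub, ← estBasis_sub]
    simp only [chiHat, chiOfLambda, Matrix.smul_apply, Matrix.add_apply, Matrix.of_apply,
      Matrix.conjTranspose_apply, smul_eq_mul, Matrix.sub_apply, star_sub]
    ring
  rw [h, norm_mul]
  have h1 := norm_add_le (estBasis (fun s t => f s t - g s t) (j.2, k.2) j.1 k.1)
    (star (estBasis (fun s t => f s t - g s t) (k.2, j.2) k.1 j.1))
  rw [norm_star] at h1
  have h2 : ‖(1 / 2 : ℂ)‖ = 1 / 2 := by simp
  rw [h2]
  linarith [hn (j.2, k.2) j.1 k.1, hn (k.2, j.2) k.1 j.1]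

end Tomography

/-! ### Continuity of spectral quantities -/

section Continuity

variable {n m : Type*} [Fintype n] [DecidableEq n] [Fintype m] [DecidableEq m]

/-- Entrywise closeness. -/
def Close {n : Type*} (δ : ℝ) (X Y : Matrix n n ℂ) : Prop := ∀ i j, ‖X i j - Y i j‖ ≤ δ

theorem Close.mono {n : Type*} {δ δ' : ℝ} {X Y : Matrix n n ℂ} (h : Close δ X Y) (hδ : δ ≤ δ') :
    Close δ' X Y := fun i j => (h i j).trans hδ

/-- The Hermitian matrices with spectrum in `[a, b]`. -/
def specBetween (n : Type*) [Fintype n] [DecidableEq n] (a b : ℝ) : Set (Matrix n n ℂ) :=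
  {X | IsSelfAdjoint X ∧ spectrum ℝ X ⊆ Set.Icc a b}

theorem mem_specBetween_iff {a b : ℝ} {X : Matrix n n ℂ} : X ∈ specBetween n a b ↔
    X.IsHermitian ∧ algebraMap ℝ (Matrix n n ℂ) a ≤ X ∧ X ≤ algebraMap ℝ (Matrix n n ℂ) b := by
  constructor
  · rintro ⟨h1, h2⟩
    exact ⟨h1, (le_iff_le_spectrum h1 a).2 fun x hx => (h2 hx).1,
      (le_algebraMap_iff_spectrum_le (a := X) h1).2 fun x hx => (h2 hx).2⟩
  · rintro ⟨h1, h2, h3⟩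
    exact ⟨h1, fun x hx => ⟨(le_iff_le_spectrum h1 a).1 h2 x hx,
      (le_algebraMap_iff_spectrum_le (a := X) h1).1 h3 x hx⟩⟩

theorem specBetween_mono {a b a' b' : ℝ} (ha : a' ≤ a) (hb : b ≤ b') :
    specBetween n a b ⊆ specBetween n a' b' :=
  fun _ h => ⟨h.1, h.2.trans (Set.Icc_subset_Icc ha hb)⟩

theorem algebraMap_zero_le_iff {X : Matrix n n ℂ} :
    algebraMap ℝ (Matrix n n ℂ) 0 ≤ X ↔ X.PosSemidef := by
  rw [map_zero, Matrix.nonneg_iff_posSemidef]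

theorem IsDensity.mem_specBetween {ρ : Matrix n n ℂ} (h : IsDensity ρ) :
    ρ ∈ specBetween n 0 1 := by
  refine ⟨h.1.isHermitian, ?_⟩
  rw [h.1.isHermitian.spectrum_real_eq_range_eigenvalues]
  rintro _ ⟨i, rfl⟩
  exact ⟨h.1.eigenvalues_nonneg i, eigenvalues_le_one h i⟩

theorem le_trace_of_posSemidef {X : Matrix n n ℂ} (h : X.PosSemidef) {c : ℝ}
    (hc : X.trace = c) : X ≤ algebraMap ℝ (Matrix n n ℂ) c := by
  rw [le_algebraMap_iff_spectrum_le (a := X) h.isHermitian,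
    h.isHermitian.spectrum_real_eq_range_eigenvalues]
  rintro _ ⟨i, rfl⟩
  have h1 : ∑ i, h.isHermitian.eigenvalues i = c := by
    simpa using (congrArg Complex.re (hc.symm.trans h.isHermitian.trace_eq_sum_eigenvalues)).symm
  rw [← h1]
  exact Finset.single_le_sum (fun i _ => h.eigenvalues_nonneg i) (Finset.mem_univ i)

open scoped Matrix.Norms.L2Operator in
theorem norm_entry_le (X : Matrix n n ℂ) (i j : n) : ‖X i j‖ ≤ ‖X‖ := by
  have h := Matrix.l2_opNorm_mulVec X (EuclideanSpace.single j (1 : ℂ))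
  have h1 : ‖EuclideanSpace.single j (1 : ℂ)‖ = 1 := by simp
  rw [h1, mul_one] at h
  refine le_trans ?_ h
  have h2 := PiLp.norm_apply_le ((EuclideanSpace.equiv n ℂ).symm
    (X *ᵥ (EuclideanSpace.single j (1 : ℂ)).ofLp)) i
  refine le_trans (le_of_eq ?_) h2
  simp

open scoped Matrix.Norms.L2Operator in
theorem exists_norm_le (n : Type*) [Fintype n] [DecidableEq n] :
    ∃ C : ℝ, 0 < C ∧ ∀ (δ : ℝ) (X Y : Matrix n n ℂ), 0 ≤ δ → Close δ X Y → ‖X - Y‖ ≤ C * δ := by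
  -- The added `1` keeps the constant positive even for an empty index type.
  refine ⟨∑ i : n, ∑ j : n, ‖Matrix.single i j (1 : ℂ)‖ + 1, by positivity, ?_⟩
  intro δ X Y hδ h
  rw [Matrix.matrix_eq_sum_single (X - Y)]
  have h1 : ∀ i j, ‖Matrix.single i j ((X - Y) i j)‖ ≤ ‖Matrix.single i j (1 : ℂ)‖ * δ := by
    intro i j
    have : Matrix.single i j ((X - Y) i j) = (X - Y) i j • Matrix.single i j (1 : ℂ) := by
      simp [Matrix.smul_single]
    rw [this, norm_smul, mul_comm]
    exact mul_le_mul_of_nonneg_left (h i j) (norm_nonneg _)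
  calc ‖∑ i, ∑ j, Matrix.single i j ((X - Y) i j)‖
      ≤ ∑ i, ∑ j, ‖Matrix.single i j ((X - Y) i j)‖ :=
        (norm_sum_le _ _).trans (Finset.sum_le_sum fun i _ => norm_sum_le _ _)
    _ ≤ ∑ i, ∑ j, ‖Matrix.single i j (1 : ℂ)‖ * δ :=
        Finset.sum_le_sum fun i _ => Finset.sum_le_sum fun j _ => h1 i j
    _ ≤ _ := by
        simp only [← Finset.sum_mul]
        rw [add_mul, one_mul]
        exact le_add_of_nonneg_right hδ

open scoped Matrix.Norms.L2Operator in
theorem mem_specBetween_of_norm_le {a b ε : ℝ} {X Y : Matrix n n ℂ} (hX : X ∈ specBetween n a b)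
    (hY : Y.IsHermitian) (h : ‖Y - X‖ ≤ ε) : Y ∈ specBetween n (a - ε) (b + ε) := by
  rw [mem_specBetween_iff] at hX ⊢
  obtain ⟨hXh, h1, h2⟩ := hX
  have hs : IsSelfAdjoint (Y - X) := hY.sub hXh
  have h3 := IsSelfAdjoint.le_algebraMap_norm_self (a := Y - X) hs
  have h4 := IsSelfAdjoint.neg_algebraMap_norm_le_self (a := Y - X) hs
  have h5 : algebraMap ℝ (Matrix n n ℂ) ‖Y - X‖ ≤ algebraMap ℝ (Matrix n n ℂ) ε :=
    algebraMap_mono _ h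
  refine ⟨hY, ?_, ?_⟩
  · have := add_le_add h1 ((neg_le_neg h5).trans h4)
    rw [map_sub]
    simpa [sub_eq_add_neg] using this
  · have := add_le_add h2 (h3.trans h5)
    rw [map_add]
    simpa using this

/-- Hermitian matrices with close entries have close spectra. -/
theorem exists_spectral_modulus (n : Type*) [Fintype n] [DecidableEq n] :
    ∃ C : ℝ, 0 < C ∧ ∀ (δ : ℝ) (X Y : Matrix n n ℂ), 0 ≤ δ → Close δ Y X → Y.IsHermitian →
      ∀ a b, X ∈ specBetween n a b → Y ∈ specBetween n (a - C * δ) (b + C * δ) := by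
  obtain ⟨C, hC, h⟩ := exists_norm_le n
  exact ⟨C, hC, fun δ X Y hδ hc hY a b hX => mem_specBetween_of_norm_le hX hY (h δ Y X hδ hc)⟩

theorem exists_lambdaMin_modulus (n : Type*) [Fintype n] [DecidableEq n] [Nonempty n] :
    ∃ C : ℝ, 0 < C ∧ ∀ (δ : ℝ) (X Y : Matrix n n ℂ), 0 ≤ δ → Close δ X Y → X.IsHermitian →
      Y.IsHermitian → |lambdaMin X - lambdaMin Y| ≤ C * δ := by
  obtain ⟨C, hC, h⟩ := exists_norm_le n
  refine ⟨C, hC, fun δ X Y hδ hc hX hY => ?_⟩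
  have h1 := lambdaMin_le_add hX hY
  have h2 := lambdaMin_le_add hY hX
  have h3 := h δ X Y hδ hc
  have h4 := h δ Y X hδ fun i j => by rw [norm_sub_rev]; exact hc i j
  rw [abs_le]
  constructor <;> linarith

-- Self-adjointness and the order bounds are closed conditions, an order interval is norm bounded,
-- and the matrix space is finite dimensional.
open scoped Matrix.Norms.L2Operator in
theorem isCompact_specBetween (n : Type*) [Fintype n] [DecidableEq n] (a b : ℝ) :
    IsCompact (specBetween n a b) := by
  have : ProperSpace (Matrix n n ℂ) := FiniteDimensional.proper ℂ _
  have heq : specBetween n a b = {X : Matrix n n ℂ | star X = X} ∩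
      Set.Icc (algebraMap ℝ (Matrix n n ℂ) a) (algebraMap ℝ (Matrix n n ℂ) b) := by
    ext X
    rw [mem_specBetween_iff]
    rfl
  refine Metric.isCompact_of_isClosed_isBounded ?_ ?_
  · rw [heq]
    exact (isClosed_eq continuous_star continuous_id).inter isClosed_Icc
  · rw [isBounded_iff_forall_norm_le]
    refine ⟨‖algebraMap ℝ (Matrix n n ℂ) b - algebraMap ℝ (Matrix n n ℂ) a‖ +
      ‖algebraMap ℝ (Matrix n n ℂ) a‖, fun X hX => ?_⟩
    obtain ⟨-, h1, h2⟩ := mem_specBetween_iff.1 hX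
    have h3 := CStarAlgebra.norm_le_norm_of_nonneg_of_le (sub_nonneg.2 h1)
      (sub_le_sub_right h2 (algebraMap ℝ (Matrix n n ℂ) a))
    have h4 := norm_add_le (X - algebraMap ℝ (Matrix n n ℂ) a) (algebraMap ℝ (Matrix n n ℂ) a)
    rw [sub_add_cancel] at h4
    linarith

open scoped Matrix.Norms.L2Operator in
theorem continuousOn_cfc_specBetween {a b : ℝ} {f : ℝ → ℝ} (hf : ContinuousOn f (Set.Icc a b)) :
    ContinuousOn (fun X : Matrix n n ℂ => cfc f X) (specBetween n a b) :=
  continuousOn_cfc (Matrix n n ℂ) isCompact_Icc f hf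

/-- The first argument may be singular: `ρ log ρ` is handled as one function, since `x log x` is
continuous at zero. Only the second argument must stay away from zero. -/
theorem continuousOn_entropyDiff {c M : ℝ} (hc : 0 < c) :
    ContinuousOn (fun p : Matrix n n ℂ × Matrix n n ℂ => entropyDiff p.1 p.2)
      (specBetween n 0 M ×ˢ specBetween n c M) := by
  have h1 : ContinuousOn (fun X : Matrix n n ℂ => cfc (fun x : ℝ => x * Real.log x) X)
      (specBetween n 0 M) := continuousOn_cfc_specBetween Real.continuous_mul_log.continuousOn
  have h2 : ContinuousOn (fun X : Matrix n n ℂ => cfc Real.log X) (specBetween n c M) :=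
    continuousOn_cfc_specBetween (Real.continuousOn_log.mono fun x hx => (hc.trans_le hx.1).ne')
  have h3 : ContinuousOn (fun p : Matrix n n ℂ × Matrix n n ℂ =>
      (cfc (fun x : ℝ => x * Real.log x) p.1 - p.1 * cfc Real.log p.2).trace.re)
      (specBetween n 0 M ×ˢ specBetween n c M) := by
    have h4 := h1.comp (continuousOn_fst (s := specBetween n 0 M ×ˢ specBetween n c M))
      fun p hp => hp.1
    have h5 := h2.comp (continuousOn_snd (s := specBetween n 0 M ×ˢ specBetween n c M))
      fun p hp => hp.2
    have h6 := h4.sub (continuousOn_fst.mul h5)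
    exact (Complex.continuous_re.comp (continuous_id.matrix_trace)).comp_continuousOn h6
  refine h3.congr fun p hp => ?_
  simp only [entropyDiff]
  rw [mul_sub, mul_cfc_log hp.1.1]

theorem continuousOn_complementOfChi {d : ℕ} (M M' : ℝ) :
    ContinuousOn (fun p : Matrix (Fin d × Fin d) (Fin d × Fin d) ℂ × Matrix (Fin d) (Fin d) ℂ =>
      complementOfChi p.1 p.2) (specBetween (Fin d × Fin d) 0 M ×ˢ specBetween (Fin d) 0 M') := by
  have h1 : ContinuousOn (fun X : Matrix (Fin d × Fin d) (Fin d × Fin d) ℂ => cfc Real.sqrt X)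
      (specBetween (Fin d × Fin d) 0 M) :=
    continuousOn_cfc_specBetween Real.continuous_sqrt.continuousOn
  have h2 := h1.comp (continuousOn_fst
    (s := specBetween (Fin d × Fin d) 0 M ×ˢ specBetween (Fin d) 0 M')) fun p hp => hp.1
  have h3 := (continuous_id.matrix_map (continuous_star (R := ℂ))).comp_continuousOn h2
  have h4 : Continuous fun ρ : Matrix (Fin d) (Fin d) ℂ =>
      (1 : Matrix (Fin d) (Fin d) ℂ) ⊗ₖ ρ := by
    refine continuous_matrix fun i j => ?_
    exact continuous_const.mul (continuous_id.matrix_elem _ _)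
  have h5 := (h3.mul (h4.comp_continuousOn (continuousOn_snd
    (s := specBetween (Fin d × Fin d) 0 M ×ˢ specBetween (Fin d) 0 M')))).mul h3
  refine h5.congr fun p hp => ?_
  simp only [complementOfChi, of_trace_opBasis]
  rfl

-- Uniform continuity on a compact set, restated with entrywise closeness.
open scoped Matrix.Norms.L2Operator in
theorem exists_modulus_of_continuousOn {E : Type*} [PseudoMetricSpace E]
    {f : Matrix n n ℂ × Matrix m m ℂ → E} {s : Set (Matrix n n ℂ × Matrix m m ℂ)}
    (hs : IsCompact s) (hf : ContinuousOn f s) {η : ℝ} (hη : 0 < η) :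
    ∃ δ : ℝ, 0 < δ ∧ ∀ p ∈ s, ∀ p' ∈ s, Close δ p.1 p'.1 → Close δ p.2 p'.2 →
      dist (f p) (f p') ≤ η := by
  have hu := Metric.uniformContinuousOn_iff.1 (hs.uniformContinuousOn_of_continuous hf) η hη
  obtain ⟨δ, hδ, h⟩ := hu
  obtain ⟨C, hC, hn⟩ := exists_norm_le n
  obtain ⟨C', hC', hm⟩ := exists_norm_le m
  have hpos : 0 < δ / (C + C') / 2 := by positivity
  have hlt : ∀ K, K ≤ C + C' → K * (δ / (C + C') / 2) < δ := by
    intro K hK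
    have h1 : K * (δ / (C + C') / 2) ≤ (C + C') * (δ / (C + C') / 2) :=
      mul_le_mul_of_nonneg_right hK hpos.le
    have h2 : (C + C') * (δ / (C + C') / 2) = δ / 2 := by field_simp
    linarith
  refine ⟨δ / (C + C') / 2, hpos, fun p hp p' hp' h1 h2 => (h p hp p' hp' ?_).le⟩
  rw [Prod.dist_eq, max_lt_iff, dist_eq_norm, dist_eq_norm]
  exact ⟨(hn _ _ _ hpos.le h1).trans_lt (hlt _ (by linarith)),
    (hm _ _ _ hpos.le h2).trans_lt (hlt _ (by linarith))⟩

theorem exists_entropyDiff_modulus (n : Type*) [Fintype n] [DecidableEq n] {c η : ℝ} (M : ℝ)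
    (hc : 0 < c) (hη : 0 < η) : ∃ δ : ℝ, 0 < δ ∧ ∀ ρ ∈ specBetween n 0 M, ∀ ρ' ∈ specBetween n 0 M,
      ∀ σ ∈ specBetween n c M, ∀ σ' ∈ specBetween n c M, Close δ ρ ρ' → Close δ σ σ' →
        |entropyDiff ρ σ - entropyDiff ρ' σ'| ≤ η := by
  obtain ⟨δ, hδ, h⟩ := exists_modulus_of_continuousOn
    ((isCompact_specBetween n 0 M).prod (isCompact_specBetween n c M))
    (continuousOn_entropyDiff hc) hη
  refine ⟨δ, hδ, fun ρ hρ ρ' hρ' σ hσ σ' hσ' h1 h2 => ?_⟩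
  have := h (ρ, σ) ⟨hρ, hσ⟩ (ρ', σ') ⟨hρ', hσ'⟩ h1 h2
  rwa [Real.dist_eq] at this

open scoped Matrix.Norms.L2Operator in
theorem exists_complementOfChi_modulus (d : ℕ) {η : ℝ} (M : ℝ) (hη : 0 < η) :
    ∃ δ : ℝ, 0 < δ ∧ ∀ χ ∈ specBetween (Fin d × Fin d) 0 M,
      ∀ χ' ∈ specBetween (Fin d × Fin d) 0 M, Close δ χ χ' →
      ∀ ρ : Matrix (Fin d) (Fin d) ℂ, IsDensity ρ →
        Close η (complementOfChi χ ρ) (complementOfChi χ' ρ) := by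
  obtain ⟨δ, hδ, h⟩ := exists_modulus_of_continuousOn
    ((isCompact_specBetween (Fin d × Fin d) 0 M).prod (isCompact_specBetween (Fin d) 0 1))
    (continuousOn_complementOfChi M 1) hη
  refine ⟨δ, hδ, fun χ hχ χ' hχ' hc ρ hρ i j => ?_⟩
  have := h (χ, ρ) ⟨hχ, hρ.mem_specBetween⟩ (χ', ρ) ⟨hχ', hρ.mem_specBetween⟩ hc
    (fun i j => by simpa using hδ.le)
  rw [dist_eq_norm] at this
  exact (norm_entry_le _ i j).trans this

end Continuity

/-! ### Unitary invariance -/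

section Unitary

variable {n m : Type*} [Fintype n] [DecidableEq n] [Fintype m] [DecidableEq m]

/-- Conjugation by a unitary between two index types. -/
def conjHom (W : Matrix m n ℂ) (h1 : Wᴴ * W = 1) (h2 : W * Wᴴ = 1) :
    Matrix n n ℂ →⋆ₐ[ℝ] Matrix m m ℂ where
  toFun X := W * X * Wᴴ
  map_one' := by rw [Matrix.mul_one, h2]
  map_mul' X Y := by
    calc W * (X * Y) * Wᴴ = W * X * (1 : Matrix n n ℂ) * Y * Wᴴ := by
          simp only [Matrix.mul_assoc, Matrix.one_mul]
      _ = W * X * Wᴴ * (W * Y * Wᴴ) := by rw [← h1]; simp only [Matrix.mul_assoc]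
  map_zero' := by simp
  map_add' X Y := by rw [Matrix.mul_add, Matrix.add_mul]
  commutes' r := by
    rw [Algebra.algebraMap_eq_smul_one, Algebra.algebraMap_eq_smul_one, Matrix.mul_smul,
      Matrix.smul_mul, Matrix.mul_one, h2]
  map_star' X := by
    simp only [Matrix.star_eq_conjTranspose, Matrix.conjTranspose_mul,
      Matrix.conjTranspose_conjTranspose, Matrix.mul_assoc]

/-- Conjugation by `W` is a continuous star homomorphism, hence commutes with the functional
calculus. The index types differ because Eve's space and the `χ` index set do. -/
theorem cfc_conj {W : Matrix m n ℂ} (h1 : Wᴴ * W = 1) (h2 : W * Wᴴ = 1) {X : Matrix n n ℂ}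
    (hX : X.IsHermitian) (f : ℝ → ℝ) : cfc f (W * X * Wᴴ) = W * cfc f X * Wᴴ := by
  have hcont : Continuous (conjHom W h1 h2) := by
    change Continuous fun X : Matrix n n ℂ => W * X * Wᴴ
    exact (continuous_const.matrix_mul continuous_id).matrix_mul continuous_const
  have := StarAlgHomClass.map_cfc (S := ℝ) (p := IsSelfAdjoint) (q := IsSelfAdjoint)
    (conjHom W h1 h2) f X (X.finite_real_spectrum.continuousOn f) hcont hX.isSelfAdjoint
    (hX.isSelfAdjoint.map _)
  exact this.symm

theorem entropyDiff_conj {W : Matrix m n ℂ} (h1 : Wᴴ * W = 1) (h2 : W * Wᴴ = 1)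
    {X Y : Matrix n n ℂ} (hX : X.IsHermitian) (hY : Y.IsHermitian) :
    entropyDiff (W * X * Wᴴ) (W * Y * Wᴴ) = entropyDiff X Y := by
  unfold entropyDiff
  rw [cfc_conj h1 h2 hX, cfc_conj h1 h2 hY, ← Matrix.sub_mul, ← Matrix.mul_sub]
  have h3 : W * X * Wᴴ * (W * (cfc Real.log X - cfc Real.log Y) * Wᴴ) =
      W * (X * (cfc Real.log X - cfc Real.log Y)) * Wᴴ := by
    rw [show W * X * Wᴴ * (W * (cfc Real.log X - cfc Real.log Y) * Wᴴ) =
      W * X * (Wᴴ * W) * (cfc Real.log X - cfc Real.log Y) * Wᴴ by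
        simp only [Matrix.mul_assoc], h1, Matrix.mul_one]
    simp only [Matrix.mul_assoc]
  rw [h3, Matrix.mul_assoc, Matrix.trace_mul_comm, Matrix.mul_assoc, h1, Matrix.mul_one]

end Unitary

/-! ### The complement in terms of the `χ` matrix -/

section Complement

variable {d e : ℕ}

theorem isHermitian_cfc {n : Type*} [Fintype n] [DecidableEq n] (f : ℝ → ℝ) (X : Matrix n n ℂ) :
    (cfc f X).IsHermitian := cfc_predicate (p := IsSelfAdjoint) f X

theorem conjTranspose_map_star {n : Type*} {R : Matrix n n ℂ} (h : R.IsHermitian) :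
    (R.map star)ᴴ = R.map star := by
  ext i j
  have := h.apply j i
  simp only [Matrix.conjTranspose_apply, Matrix.map_apply, star_star]
  exact this.symm

theorem transpose_eq_map_star {n : Type*} {R : Matrix n n ℂ} (h : R.IsHermitian) :
    Rᵀ = R.map star := by
  ext i j
  exact (h.apply j i).symm

theorem posSemidef_complementOfChi (χ : Matrix (Fin d × Fin d) (Fin d × Fin d) ℂ)
    {ρ : Matrix (Fin d) (Fin d) ℂ} (h : ρ.PosSemidef) : (complementOfChi χ ρ).PosSemidef := by
  rw [complementOfChi, of_trace_opBasis]
  have := (Matrix.PosSemidef.one.kronecker h :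
    ((1 : Matrix (Fin d) (Fin d) ℂ) ⊗ₖ ρ).PosSemidef).mul_mul_conjTranspose_same
    ((cfc Real.sqrt χ).map star)
  rwa [conjTranspose_map_star (isHermitian_cfc _ _)] at this

theorem cfc_sqrt_mul_self {n : Type*} [Fintype n] [DecidableEq n] {X : Matrix n n ℂ}
    (h : X.PosSemidef) : cfc Real.sqrt X * cfc Real.sqrt X = X := by
  have hf : ContinuousOn Real.sqrt (spectrum ℝ X) := Real.continuous_sqrt.continuousOn
  rw [← cfc_mul Real.sqrt Real.sqrt X hf hf]
  conv_rhs => rw [← cfc_id' ℝ X h.isHermitian.isSelfAdjoint]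
  refine cfc_congr fun x hx => ?_
  rw [h.isHermitian.spectrum_real_eq_range_eigenvalues] at hx
  obtain ⟨i, rfl⟩ := hx
  exact Real.mul_self_sqrt (h.eigenvalues_nonneg i)

/-- If `χ` and one output of the complementary channel have full rank, then the complementary
channel is unitarily equivalent to the one computed from `χ`. -/
theorem exists_unitary_complement {V : Matrix (Fin d × Fin e) (Fin d) ℂ}
    {Φ : Matrix (Fin d) (Fin d) ℂ →ₗ[ℂ] Matrix (Fin d) (Fin d) ℂ}
    (h : IsIsometricExtension V Φ) (hχ : (chi Φ).PosDef) {ρ₀ : Matrix (Fin d) (Fin d) ℂ}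
    (h₀ : (complement V ρ₀).PosDef) :
    ∃ W : Matrix (Fin e) (Fin d × Fin d) ℂ, Wᴴ * W = 1 ∧ W * Wᴴ = 1 ∧
      ∀ ρ, complement V ρ = W * complementOfChi (chi Φ) ρ * Wᴴ := by
  set R := cfc Real.sqrt (chi Φ)
  set K := krausMatrix V
  have hRR : R * R = chi Φ := cfc_sqrt_mul_self hχ.posSemidef
  have hRh : R.IsHermitian := isHermitian_cfc _ _
  have hR : IsUnit R := by
    have := hχ.isUnit
    rw [← hRR] at this
    exact isUnit_of_mul_isUnit_left this
  have hdet := (Matrix.isUnit_iff_isUnit_det _).1 hR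
  have hU : R * (R⁻¹ * K) = K := by rw [← Matrix.mul_assoc, Matrix.mul_nonsing_inv _ hdet,
    Matrix.one_mul]
  -- Polar decomposition `K = R U` with `R = √χ`; then `U U† = R⁻¹ χ R⁻¹ = 1`.
  set U := R⁻¹ * K
  have hUU : U * Uᴴ = 1 := by
    simp only [U]
    rw [Matrix.conjTranspose_mul, Matrix.conjTranspose_nonsing_inv, hRh.eq, Matrix.mul_assoc,
      ← Matrix.mul_assoc K, ← chi_eq_krausMatrix h, ← hRR, ← Matrix.mul_assoc, ← Matrix.mul_assoc,
      Matrix.nonsing_inv_mul _ hdet, Matrix.one_mul, Matrix.mul_nonsing_inv _ hdet]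
  have hWH : (Uᵀ)ᴴ = U.map star := by
    ext i j
    rfl
  have h1 : (Uᵀ)ᴴ * Uᵀ = 1 := by
    have := congrArg Matrix.transpose hUU
    rw [Matrix.transpose_mul, Matrix.transpose_one] at this
    exact this
  have hc : ∀ ρ, complement V ρ = Uᵀ * complementOfChi (chi Φ) ρ * (Uᵀ)ᴴ := by
    intro ρ
    rw [complement_eq_krausMatrix, complementOfChi, of_trace_opBasis]
    change Kᵀ * _ * K.map star = Uᵀ * (R.map star * _ * R.map star) * (Uᵀ)ᴴ
    have hK : K.map star = R.map star * U.map star := by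
      conv_lhs => rw [← hU]
      exact Matrix.map_mul (f := starRingEnd ℂ)
    have hKT : Kᵀ = Uᵀ * R.map star := by
      conv_lhs => rw [← hU]
      rw [Matrix.transpose_mul, transpose_eq_map_star hRh]
    rw [hK, hKT, hWH]
    simp only [Matrix.mul_assoc]
  refine ⟨Uᵀ, h1, ?_, hc⟩
  have hdet0 := (Matrix.isUnit_iff_isUnit_det _).1 h₀.isUnit
  -- The projection onto the range of the isometry `Uᵀ` fixes the innocent output. As that output is
  -- invertible, the projection is the identity and `Uᵀ` is unitary.
  have h2 : Uᵀ * (Uᵀ)ᴴ * complement V ρ₀ = complement V ρ₀ := by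
    rw [hc ρ₀]
    rw [show Uᵀ * (Uᵀ)ᴴ * (Uᵀ * complementOfChi (chi Φ) ρ₀ * (Uᵀ)ᴴ) =
      Uᵀ * ((Uᵀ)ᴴ * Uᵀ) * complementOfChi (chi Φ) ρ₀ * (Uᵀ)ᴴ by simp only [Matrix.mul_assoc], h1,
      Matrix.mul_one]
  have h3 := congrArg (· * (complement V ρ₀)⁻¹) h2
  simp only [Matrix.mul_assoc, Matrix.mul_nonsing_inv _ hdet0, Matrix.mul_one] at h3
  exact h3

end Complement

/-! ### The output in terms of the `χ` matrix -/

section Output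

variable {d : ℕ}

theorem norm_apply_le_one {n : Type*} [Fintype n] [DecidableEq n] {ρ : Matrix n n ℂ}
    (h : IsDensity ρ) (i j : n) : ‖ρ i j‖ ≤ 1 := by
  obtain ⟨B, hB⟩ := CStarAlgebra.nonneg_iff_eq_star_mul_self.1 h.1.nonneg
  have hB' : ρ = Bᴴ * B := hB
  have htr : ∑ i, ∑ k, ‖B k i‖ ^ 2 = 1 := by
    have h1 := h.2
    rw [hB', Matrix.trace] at h1
    simp only [Matrix.diag_apply, Matrix.mul_apply, Matrix.conjTranspose_apply, RCLike.star_def,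
      Complex.conj_mul'] at h1
    exact_mod_cast h1
  have hcol : ∀ i, ∑ k, ‖B k i‖ ^ 2 ≤ 1 := fun i => by
    rw [← htr]
    exact Finset.single_le_sum (f := fun i => ∑ k, ‖B k i‖ ^ 2)
      (fun i _ => Finset.sum_nonneg fun k _ => sq_nonneg _) (Finset.mem_univ i)
  rw [hB', Matrix.mul_apply]
  calc ‖∑ k, Bᴴ i k * B k j‖ ≤ ∑ k, (‖B k i‖ ^ 2 + ‖B k j‖ ^ 2) / 2 := by
        refine (norm_sum_le _ _).trans (Finset.sum_le_sum fun k _ => ?_)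
        rw [norm_mul, Matrix.conjTranspose_apply, norm_star]
        nlinarith [sq_nonneg (‖B k i‖ - ‖B k j‖)]
    _ ≤ 1 := by
        rw [← Finset.sum_div, Finset.sum_add_distrib]
        linarith [hcol i, hcol j]

theorem close_applyChi {χ χ' : Matrix (Fin d × Fin d) (Fin d × Fin d) ℂ} {δ : ℝ}
    (h : Close δ χ χ') {ρ : Matrix (Fin d) (Fin d) ℂ} (hρ : IsDensity ρ) :
    Close (d ^ 2 * δ) (applyChi χ ρ) (applyChi χ' ρ) := by
  intro n n'
  rw [applyChi_apply, applyChi_apply, ← Finset.sum_sub_distrib]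
  have : ∀ m m', ‖χ (n, m) (n', m') * ρ m m' - χ' (n, m) (n', m') * ρ m m'‖ ≤ δ := by
    intro m m'
    rw [← sub_mul, norm_mul]
    exact (mul_le_of_le_one_right (norm_nonneg _) (norm_apply_le_one hρ m m')).trans (h _ _)
  calc _ ≤ ∑ _m : Fin d, ∑ _m' : Fin d, δ := by
        refine (norm_sum_le _ _).trans (Finset.sum_le_sum fun m _ => ?_)
        rw [← Finset.sum_sub_distrib]
        exact (norm_sum_le _ _).trans (Finset.sum_le_sum fun m' _ => this m m')
    _ = d ^ 2 * δ := by
        simp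
        ring

theorem applyChi_sub (χ χ' : Matrix (Fin d × Fin d) (Fin d × Fin d) ℂ)
    (ρ : Matrix (Fin d) (Fin d) ℂ) : applyChi (χ - χ') ρ = applyChi χ ρ - applyChi χ' ρ := by
  ext n n'
  simp only [applyChi_apply, Matrix.sub_apply, sub_mul, Finset.sum_sub_distrib]

theorem applyChi_algebraMap (c : ℝ) {ρ : Matrix (Fin d) (Fin d) ℂ} (h : ρ.trace = 1) :
    applyChi (algebraMap ℝ _ c) ρ = algebraMap ℝ _ c := by
  ext n n'
  rw [applyChi_apply]
  simp only [Algebra.algebraMap_eq_smul_one, Matrix.smul_apply, Matrix.one_apply, Prod.mk.injEq]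
  by_cases hn : n = n'
  · have : ∑ m, ρ m m = 1 := h
    simp [hn, ← Finset.mul_sum, this]
  · simp [hn]

/-- Factoring `χ = B†B` and `ρ = C†C` exhibits the output as a Gram matrix. -/
theorem posSemidef_applyChi {χ : Matrix (Fin d × Fin d) (Fin d × Fin d) ℂ} (hχ : χ.PosSemidef)
    {ρ : Matrix (Fin d) (Fin d) ℂ} (hρ : ρ.PosSemidef) : (applyChi χ ρ).PosSemidef := by
  obtain ⟨B, hB⟩ := CStarAlgebra.nonneg_iff_eq_star_mul_self.1 hχ.nonneg
  obtain ⟨C, hC⟩ := CStarAlgebra.nonneg_iff_eq_star_mul_self.1 hρ.nonneg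
  have hB' : χ = Bᴴ * B := hB
  have hC' : ρ = Cᴴ * C := hC
  let Z : Matrix ((Fin d × Fin d) × Fin d) (Fin d) ℂ :=
    Matrix.of fun ab n => ∑ m, B ab.1 (n, m) * C ab.2 m
  have : applyChi χ ρ = Zᴴ * Z := by
    ext n n'
    rw [applyChi_apply, hB', hC']
    have h1 : ∀ m m', (Bᴴ * B) (n, m) (n', m') * (Cᴴ * C) m m' =
        ∑ ab : (Fin d × Fin d) × Fin d, star (B ab.1 (n, m) * C ab.2 m) *
          (B ab.1 (n', m') * C ab.2 m') := by
      intro m m'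
      rw [Matrix.mul_apply, Matrix.mul_apply, Finset.sum_mul_sum, ← Fintype.sum_prod_type']
      refine Finset.sum_congr rfl fun ab _ => ?_
      rw [Matrix.conjTranspose_apply, Matrix.conjTranspose_apply, star_mul']
      ring
    simp only [h1]
    rw [Finset.sum_congr rfl fun m _ => Finset.sum_comm, Finset.sum_comm, Matrix.mul_apply]
    refine Finset.sum_congr rfl fun ab _ => ?_
    simp only [Matrix.conjTranspose_apply, Z, Matrix.of_apply, star_sum, Finset.sum_mul_sum]
  rw [this]
  exact Matrix.posSemidef_conjTranspose_mul_self _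

theorem isHermitian_applyChi {χ : Matrix (Fin d × Fin d) (Fin d × Fin d) ℂ} (hχ : χ.IsHermitian)
    {ρ : Matrix (Fin d) (Fin d) ℂ} (hρ : ρ.IsHermitian) : (applyChi χ ρ).IsHermitian := by
  ext n n'
  rw [Matrix.conjTranspose_apply, applyChi_apply, applyChi_apply]
  simp only [star_sum, star_mul']
  rw [Finset.sum_comm]
  refine Finset.sum_congr rfl fun m _ => Finset.sum_congr rfl fun m' _ => ?_
  rw [hχ.apply, hρ.apply]

/-- `applyChi` is monotone in `χ`, and `χ = c · 1` sends every density to `c · 1`. Thus spectral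
bounds on `χ` pass to all outputs, with the same constants. -/
theorem applyChi_mem_specBetween {χ : Matrix (Fin d × Fin d) (Fin d × Fin d) ℂ} {a b : ℝ}
    (hχ : χ ∈ specBetween (Fin d × Fin d) a b) {ρ : Matrix (Fin d) (Fin d) ℂ} (hρ : IsDensity ρ) :
    applyChi χ ρ ∈ specBetween (Fin d) a b := by
  obtain ⟨-, h1, h2⟩ := mem_specBetween_iff.1 hχ
  have h3 := posSemidef_applyChi (Matrix.le_iff.1 h1) hρ.1
  have h4 := posSemidef_applyChi (Matrix.le_iff.1 h2) hρ.1
  rw [applyChi_sub, applyChi_algebraMap _ hρ.2] at h3 h4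
  exact mem_specBetween_iff.2 ⟨isHermitian_applyChi hχ.1 hρ.1.isHermitian, Matrix.le_iff.2 h3,
    Matrix.le_iff.2 h4⟩

end Output

/-! ### Accuracy of the plug-in estimators -/

section Accuracy

theorem applyChi_chi_eq {d : ℕ} (Φ : Matrix (Fin d) (Fin d) ℂ →ₗ[ℂ] Matrix (Fin d) (Fin d) ℂ)
    (ρ : Matrix (Fin d) (Fin d) ℂ) : Φ ρ = applyChi (chi Φ) ρ := (applyChi_chi Φ ρ).symm

theorem posDef_of_mem_specBetween {n : Type*} [Fintype n] [DecidableEq n] {a b : ℝ} (ha : 0 < a)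
    {X : Matrix n n ℂ} (h : X ∈ specBetween n a b) : X.PosDef :=
  posDef_of_algebraMap_le ha (mem_specBetween_iff.1 h).2.1

theorem chi_mem_specBetween {d e : ℕ} {V : Matrix (Fin d × Fin e) (Fin d) ℂ}
    {Φ : Matrix (Fin d) (Fin d) ℂ →ₗ[ℂ] Matrix (Fin d) (Fin d) ℂ}
    (h : IsIsometricExtension V Φ) [Nonempty (Fin d)] {c : ℝ} (hc : c ≤ lambdaMin (chi Φ)) :
    chi Φ ∈ specBetween (Fin d × Fin d) c d := by
  have hp := posSemidef_chi h
  exact mem_specBetween_iff.2 ⟨hp.isHermitian, (le_lambdaMin_iff hp.isHermitian c).1 hc,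
    le_trace_of_posSemidef hp (by rw [trace_chi h]; simp)⟩

theorem IsDensity.isHermitian {n : Type*} [Fintype n] {ρ : Matrix n n ℂ} (h : IsDensity ρ) :
    ρ.IsHermitian := h.1.isHermitian

theorem isHermitian_chi {d e : ℕ} {V : Matrix (Fin d × Fin e) (Fin d) ℂ}
    {Φ : Matrix (Fin d) (Fin d) ℂ →ₗ[ℂ] Matrix (Fin d) (Fin d) ℂ}
    (h : IsIsometricExtension V Φ) : (chi Φ).IsHermitian := (posSemidef_chi h).isHermitian

/-- For channels whose `χ` matrix and whose innocent output at the eavesdropper are bounded below,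
the relative entropies at both receivers depend uniformly continuously on the `χ` matrix. -/
theorem exists_accuracy (d : ℕ) [Nonempty (Fin d)] {τ c lE : ℝ} (hτ : 0 < τ) (hc : 0 < c)
    (hE : 0 < lE) : ∃ δ : ℝ, 0 < δ ∧ ∀ (e : ℕ)
      (Φ : Matrix (Fin d) (Fin d) ℂ →ₗ[ℂ] Matrix (Fin d) (Fin d) ℂ)
      (V : Matrix (Fin d × Fin e) (Fin d) ℂ) (ρ₀ ρ₁ : Matrix (Fin d) (Fin d) ℂ)
      (χ' : Matrix (Fin d × Fin d) (Fin d × Fin d) ℂ),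
      IsIsometricExtension V Φ → IsDensity ρ₀ → IsDensity ρ₁ → c ≤ lambdaMin (chi Φ) →
      lE ≤ lambdaMin (complement V ρ₀) → χ'.IsHermitian → Close δ χ' (chi Φ) →
      ∃ a a' b b' : ℝ, relEntropy (Φ ρ₁) (Φ ρ₀) = a ∧
        relEntropy (applyChi χ' ρ₁) (applyChi χ' ρ₀) = a' ∧
        relEntropy (complement V ρ₁) (complement V ρ₀) = b ∧
        relEntropy (complementOfChi χ' ρ₁) (complementOfChi χ' ρ₀) = b' ∧
        |a' - a| ≤ τ ∧ |b' - b| ≤ τ := by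
  obtain ⟨C, hC, hspec⟩ := exists_spectral_modulus (Fin d × Fin d)
  obtain ⟨δB, hδB, hB⟩ := exists_entropyDiff_modulus (Fin d) (d + 1) (half_pos hc) hτ
  obtain ⟨δE, hδE, hEm⟩ := exists_entropyDiff_modulus (Fin d × Fin d) 2 (half_pos hE) hτ
  -- Small enough for the entropy modulus and for the spectrum of Eve's innocent output, initially
  -- in `[lE, 1]`, to stay in `[lE/2, 2]`.
  set η : ℝ := min δE (min (lE / 2) 1 / C)
  have hm : 0 < min (lE / 2) 1 := lt_min (half_pos hE) one_pos
  have hη : 0 < η := lt_min hδE (div_pos hm hC)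
  obtain ⟨δS, hδS, hS⟩ := exists_complementOfChi_modulus d (d + 1) hη
  have hm' : 0 < min (c / 2) 1 := lt_min (half_pos hc) one_pos
  -- Three demands: the spectrum of the perturbed `χ` stays in `[c/2, d + 1]`; Bob's outputs, whose
  -- entries move by at most `d² δ`, stay within `δB`; Eve's outputs stay within `η`.
  set δ : ℝ := min (min (c / 2) 1 / C) (min (δB / (d ^ 2 + 1)) δS)
  have hδ : 0 < δ := lt_min (div_pos hm' hC) (lt_min (by positivity) hδS)
  refine ⟨δ, hδ, ?_⟩
  intro e Φ V ρ₀ ρ₁ χ' hV h₀ h₁ hcχ hlE hχ' hclose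
  have hχ := chi_mem_specBetween hV hcχ
  have hCδ : C * δ ≤ min (c / 2) 1 := by
    rw [mul_comm, ← le_div_iff₀ hC]
    exact min_le_left _ _
  have hχ'm : χ' ∈ specBetween (Fin d × Fin d) (c / 2) (d + 1) :=
    specBetween_mono (by linarith [hCδ.trans (min_le_left _ _)])
      (by linarith [hCδ.trans (min_le_right _ _)]) (hspec δ _ _ hδ.le hclose hχ' _ _ hχ)
  have hχm : chi Φ ∈ specBetween (Fin d × Fin d) (c / 2) (d + 1) :=
    specBetween_mono (by linarith) (by linarith) hχ
  have hd2 : (d : ℝ) ^ 2 * δ ≤ δB := by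
    have h1 : δ ≤ δB / (d ^ 2 + 1) := (min_le_right _ _).trans (min_le_left _ _)
    rw [le_div_iff₀ (by positivity)] at h1
    nlinarith
  have hA : ∀ {χ : Matrix (Fin d × Fin d) (Fin d × Fin d) ℂ} {ρ : Matrix (Fin d) (Fin d) ℂ},
      χ ∈ specBetween (Fin d × Fin d) (c / 2) (d + 1) → IsDensity ρ →
      applyChi χ ρ ∈ specBetween (Fin d) (c / 2) (d + 1) := fun h1 h2 =>
    applyChi_mem_specBetween h1 h2
  have hdown : specBetween (Fin d) (c / 2) (d + 1) ⊆ specBetween (Fin d) 0 (d + 1) :=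
    specBetween_mono (half_pos hc).le le_rfl
  have hdown' : specBetween (Fin d × Fin d) (c / 2) (d + 1) ⊆
      specBetween (Fin d × Fin d) 0 (d + 1) := specBetween_mono (half_pos hc).le le_rfl
  have hab := hB _ (hdown (hA hχ'm h₁)) _ (hdown (hA hχm h₁)) _ (hA hχ'm h₀) _ (hA hχm h₀)
    ((close_applyChi hclose h₁).mono hd2) ((close_applyChi hclose h₀).mono hd2)
  have hσd := isDensity_complement hV.1 h₀
  have := hσd.nonempty
  have hσle := (le_lambdaMin_iff hσd.1.isHermitian lE).1 hlE
  have hσ := posDef_of_algebraMap_le hE hσle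
  obtain ⟨W, hW1, hW2, hW⟩ := exists_unitary_complement hV (posDef_of_mem_specBetween hc hχ) hσ
  have hcompl : ∀ ρ, complementOfChi (chi Φ) ρ = Wᴴ * complement V ρ * W := by
    intro ρ
    rw [hW, show Wᴴ * (W * complementOfChi (chi Φ) ρ * Wᴴ) * W =
      Wᴴ * W * complementOfChi (chi Φ) ρ * (Wᴴ * W) by simp only [Matrix.mul_assoc], hW1,
      Matrix.one_mul, Matrix.mul_one]
  have hdens : ∀ ρ, IsDensity ρ → IsDensity (complementOfChi (chi Φ) ρ) := by
    intro ρ hρ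
    have h2 : (Wᴴ)ᴴ * Wᴴ = 1 := by rw [Matrix.conjTranspose_conjTranspose, hW2]
    have h1 := isDensity_isometry h2 (isDensity_complement hV.1 hρ)
    rwa [Matrix.conjTranspose_conjTranspose, ← hcompl] at h1
  have h₀E : complementOfChi (chi Φ) ρ₀ ∈ specBetween (Fin d × Fin d) lE 1 := by
    obtain ⟨g1, -, g3⟩ := mem_specBetween_iff.1 (hdens ρ₀ h₀).mem_specBetween
    refine mem_specBetween_iff.2 ⟨g1, ?_, g3⟩
    rw [Matrix.le_iff] at hσle ⊢
    have h1 := hσle.conjTranspose_mul_mul_same W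
    rwa [Matrix.mul_sub, Matrix.sub_mul, ← hcompl, Algebra.algebraMap_eq_smul_one,
      Matrix.mul_smul, Matrix.smul_mul, Matrix.mul_one, hW1,
      ← Algebra.algebraMap_eq_smul_one] at h1
  have hcE : ∀ ρ, IsDensity ρ →
      Close η (complementOfChi χ' ρ) (complementOfChi (chi Φ) ρ) := fun ρ hρ =>
    hS χ' (hdown' hχ'm) (chi Φ) (hdown' hχm)
      (hclose.mono ((min_le_right _ _).trans (min_le_right _ _))) ρ hρ
  have hCη : C * η ≤ min (lE / 2) 1 := by
    rw [mul_comm, ← le_div_iff₀ hC]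
    exact min_le_right _ _
  have h₀E' : complementOfChi χ' ρ₀ ∈ specBetween (Fin d × Fin d) (lE / 2) 2 :=
    specBetween_mono (by linarith [hCη.trans (min_le_left _ _)])
      (by linarith [hCη.trans (min_le_right _ _)])
      (hspec η _ _ hη.le (hcE ρ₀ h₀) (posSemidef_complementOfChi χ' h₀.1).isHermitian _ _ h₀E)
  have h₁E : complementOfChi (chi Φ) ρ₁ ∈ specBetween (Fin d × Fin d) 0 1 :=
    (hdens ρ₁ h₁).mem_specBetween
  -- Perturbation supplies only the upper bound `2`; the lower bound `0` comes from positivity,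
  -- since this output may be singular.
  have h₁E' : complementOfChi χ' ρ₁ ∈ specBetween (Fin d × Fin d) 0 2 := by
    have hp := posSemidef_complementOfChi χ' h₁.1
    have h1 := hspec η _ _ hη.le (hcE ρ₁ h₁) hp.isHermitian _ _ h₁E
    obtain ⟨g1, -, g3⟩ := mem_specBetween_iff.1
      (specBetween_mono le_rfl (by linarith [hCη.trans (min_le_right _ _)]) h1 :
        _ ∈ specBetween (Fin d × Fin d) _ 2)
    exact mem_specBetween_iff.2 ⟨g1, algebraMap_zero_le_iff.2 hp, g3⟩
  have hEab := hEm _ h₁E' _ (specBetween_mono le_rfl one_le_two h₁E) _ h₀E' _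
    (specBetween_mono (by linarith) one_le_two h₀E)
    ((hcE ρ₁ h₁).mono (min_le_left _ _)) ((hcE ρ₀ h₀).mono (min_le_left _ _))
  refine ⟨_, _, _, _, ?_, relEntropy_of_posDef _ (posDef_of_mem_specBetween (half_pos hc)
    (hA hχ'm h₀)), ?_, relEntropy_of_posDef _ (posDef_of_mem_specBetween (half_pos hE) h₀E'),
    hab, hEab⟩
  · rw [applyChi_chi_eq Φ ρ₁, applyChi_chi_eq Φ ρ₀]
    exact relEntropy_of_posDef _ (posDef_of_mem_specBetween (half_pos hc) (hA hχm h₀))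
  · rw [relEntropy_of_posDef _ hσ, hW ρ₁, hW ρ₀, entropyDiff_conj hW1 hW2
      (hdens ρ₁ h₁).1.isHermitian (hdens ρ₀ h₀).1.isHermitian]

end Accuracy

end
end CovertTomography

/-! ### Choice of constants and proof of the theorem -/

open CovertTomography
open scoped Matrix Kronecker
theorem mainTheorem4 (d : ℕ) (τ lχ lB lE : ℝ) (hτ : 0 < τ)
    (hχ : 0 < lχ ∧ lχ ≤ 1) (hB : 0 < lB ∧ lB ≤ 1) (hE : 0 < lE ∧ lE ≤ 1) :
    ∃ ξ : ℝ, 0 < ξ ∧ ∃ ℓ₀ : ℕ,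
      ∀ (e : ℕ) (Φ : Matrix (Fin d) (Fin d) ℂ →ₗ[ℂ] Matrix (Fin d) (Fin d) ℂ)
        (V : Matrix (Fin d × Fin e) (Fin d) ℂ) (ρ₀ ρ₁ : Matrix (Fin d) (Fin d) ℂ)
        (T q ℓ : ℕ) (S : Schedule d ℓ),
        IsChannel Φ → IsIsometricExtension V Φ → IsDensity ρ₀ → IsDensity ρ₁ →
        1 ≤ q → q * ℓ ≤ T →
        -- covertness
        (lE ≤ lambdaMin (complement V ρ₀) →
          ∀ (b : ℕ) (g : Outcome ℓ → (Fin b → ZMod 2)),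
            relEntropy (stateEW (q := q) T V ρ₀ S g)
                (tensor (fun _ : Fin T => complement V ρ₀) ⊗ₖ uniformW b)
              ≤ (((ℓ : ℝ) / q * ((e : ℝ) / lE - 1) : ℝ) : EReal)) ∧
        (ℓ₀ ≤ ℓ →
          -- wrong abortion
          (lχ ≤ lambdaMin (chi Φ) → lB ≤ lambdaMin (Φ ρ₀) →
            prob (q := q) T Φ ρ₀ S (fun j => testH lχ lB τ ρ₀ S j = 0)
              ≤ (2 : ℝ) ^ (-(ξ * ℓ))) ∧
          -- wrong acceptance
          (lambdaMin (chi Φ) ≤ lχ - 2 * τ ∨ lambdaMin (Φ ρ₀) ≤ lB - 2 * τ →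
            prob (q := q) T Φ ρ₀ S (fun j => testH lχ lB τ ρ₀ S j = 1)
              ≤ (2 : ℝ) ^ (-(ξ * ℓ))) ∧
          -- accuracy
          (2 * τ < lχ → lE ≤ lambdaMin (complement V ρ₀) →
            lχ - 2 * τ ≤ lambdaMin (chi Φ) → lB - 2 * τ ≤ lambdaMin (Φ ρ₀) →
            1 - (2 : ℝ) ^ (-(ξ * ℓ)) ≤
              prob (q := q) T Φ ρ₀ S (fun j =>
                relEntropy (Φ ρ₁) (Φ ρ₀) - ((2 * τ : ℝ) : EReal) ≤ estB τ ρ₀ ρ₁ S j ∧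
                estB τ ρ₀ ρ₁ S j ≤ relEntropy (Φ ρ₁) (Φ ρ₀) ∧
                relEntropy (complement V ρ₁) (complement V ρ₀) ≤ estE τ ρ₀ ρ₁ S j ∧
                estE τ ρ₀ ρ₁ S j ≤
                  relEntropy (complement V ρ₁) (complement V ρ₀) + ((2 * τ : ℝ) : EReal)))) := by
  -- In dimension zero there is no density operator.
  rcases Nat.eq_zero_or_pos d with hd | hd
  · refine ⟨1, one_pos, 0, ?_⟩
    intro e Φ V ρ₀ ρ₁ T q ℓ S _ _ h₀
    obtain ⟨i⟩ := h₀.nonempty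
    exact absurd i.2 (by omega)
  have : Nonempty (Fin d) := ⟨⟨0, hd⟩⟩
  obtain ⟨C, hC, hmod⟩ := exists_lambdaMin_modulus (Fin d × Fin d)
  obtain ⟨C', hC', hmod'⟩ := exists_lambdaMin_modulus (Fin d)
  -- The constants precede the hypothesis `2 * τ < lχ` of the accuracy claim, so `δ` is chosen by
  -- cases; if it fails, any `δ` serves.
  obtain ⟨δ, hδ, hacc⟩ : ∃ δ : ℝ, 0 < δ ∧ (2 * τ < lχ → ∀ (e : ℕ)
      (Φ : Matrix (Fin d) (Fin d) ℂ →ₗ[ℂ] Matrix (Fin d) (Fin d) ℂ)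
      (V : Matrix (Fin d × Fin e) (Fin d) ℂ) (ρ₀ ρ₁ : Matrix (Fin d) (Fin d) ℂ)
      (χ' : Matrix (Fin d × Fin d) (Fin d × Fin d) ℂ),
      IsIsometricExtension V Φ → IsDensity ρ₀ → IsDensity ρ₁ → lχ - 2 * τ ≤ lambdaMin (chi Φ) →
      lE ≤ lambdaMin (complement V ρ₀) → χ'.IsHermitian → Close δ χ' (chi Φ) →
      ∃ a a' b b' : ℝ, relEntropy (Φ ρ₁) (Φ ρ₀) = a ∧
        relEntropy (applyChi χ' ρ₁) (applyChi χ' ρ₀) = a' ∧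
        relEntropy (complement V ρ₁) (complement V ρ₀) = b ∧
        relEntropy (complementOfChi χ' ρ₁) (complementOfChi χ' ρ₀) = b' ∧
        |a' - a| ≤ τ ∧ |b' - b| ≤ τ) := by
    by_cases h : 2 * τ < lχ
    · obtain ⟨δ, hδ, hacc⟩ := exists_accuracy d hτ (sub_pos.2 h) hE.1
      exact ⟨δ, hδ, fun _ => hacc⟩
    · exact ⟨1, one_pos, fun h' => absurd h' h⟩
  set K : ℝ := C + d ^ 2 * C'
  have hK : 0 < K := by positivity
  -- Entries of `χ̂` err by at most `16 ε`: this must be below `δ` for the entropies, and `16 ε K ≤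
  -- τ/2` for both smallest eigenvalues. The tail bound needs `ε ≤ 1`.
  set ε : ℝ := min 1 (min (δ / 16) (τ / (32 * K)))
  have hε : 0 < ε := lt_min one_pos (lt_min (by positivity) (by positivity))
  obtain ⟨ξ, hξ, ℓ₀, hexp⟩ := exists_exponent hd hε
  refine ⟨ξ, hξ, ℓ₀, ?_⟩
  intro e Φ V ρ₀ ρ₁ T q ℓ S _ hV h₀ h₁ hq hT
  refine ⟨fun hmin b g => relEntropy_stateEW_le hq hT hV.1 h₀ hE.1 hE.2 hmin g, fun hℓ => ?_⟩
  have hΦ := hV.preservesDensity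
  have hbad : prob (q := q) T Φ ρ₀ S (fun j => ¬ FreqClose Φ S ε j) ≤ (2 : ℝ) ^ (-(ξ * ℓ)) :=
    (prob_not_freqClose_le hΦ h₀ hq hT hε (min_le_left _ _)).trans (hexp ℓ hℓ)
  have hclose : ∀ j, FreqClose Φ S ε j → Close (16 * ε) (chiHat (freq S j)) (chi Φ) := by
    intro j hj
    rw [← chiHat_probeProb hV]
    exact norm_chiHat_sub_le hj
  have hKε : 16 * ε * K ≤ τ / 2 := by
    have h1 : ε ≤ τ / (32 * K) := (min_le_right _ _).trans (min_le_right _ _)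
    rw [le_div_iff₀ (by positivity)] at h1
    linarith
  have hχh := isHermitian_chi hV
  have hev : ∀ j, FreqClose Φ S ε j →
      |lambdaMin (chiHat (freq S j)) - lambdaMin (chi Φ)| ≤ τ / 2 ∧
      |lambdaMin (applyChi (chiHat (freq S j)) ρ₀) - lambdaMin (Φ ρ₀)| ≤ τ / 2 := by
    intro j hj
    have h1 := hmod (16 * ε) _ _ (by positivity) (hclose j hj) (isHermitian_chiHat _) hχh
    have h2 := hmod' (d ^ 2 * (16 * ε)) _ _ (by positivity) (close_applyChi (hclose j hj) h₀)
      (isHermitian_applyChi (isHermitian_chiHat _) h₀.isHermitian)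
      (isHermitian_applyChi hχh h₀.isHermitian)
    rw [← applyChi_chi_eq] at h2
    have h3 : 16 * ε * K = C * (16 * ε) + C' * (d ^ 2 * (16 * ε)) := by
      simp only [K]
      ring
    have h4 : 0 ≤ C * (16 * ε) := by positivity
    have h5 : 0 ≤ C' * (d ^ 2 * (16 * ε)) := by positivity
    exact ⟨by linarith, by linarith⟩
  -- In the two abort claims the true eigenvalue at issue is at least `τ` beyond the threshold, but
  -- its estimate errs by at most `τ/2`; a wrong decision therefore forces the bad event.
  refine ⟨fun h1 h2 => ?_, fun h => ?_, fun h2τ hlE h1 _ => ?_⟩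
  · refine (prob_mono hΦ h₀ hq hT fun j hj hgood => ?_).trans hbad
    obtain ⟨g1, g2⟩ := hev j hgood
    rw [abs_le] at g1 g2
    rw [testH, if_pos ⟨by linarith [g1.1], by linarith [g2.1]⟩] at hj
    exact one_ne_zero hj
  · refine (prob_mono hΦ h₀ hq hT fun j hj hgood => ?_).trans hbad
    obtain ⟨g1, g2⟩ := hev j hgood
    rw [abs_le] at g1 g2
    rw [testH, if_neg] at hj
    · exact zero_ne_one hj
    · rintro ⟨k1, k2⟩
      rcases h with h | h <;> linarith [g1.2, g2.2]
  · have hsum := prob_add_prob_not hΦ h₀ hq hT (S := S) (FreqClose Φ S ε)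
    refine le_trans (by linarith) (prob_mono hΦ h₀ hq hT (A := FreqClose Φ S ε) fun j hj => ?_)
    have h16 : 16 * ε ≤ δ := by
      have : ε ≤ δ / 16 := (min_le_right _ _).trans (min_le_left _ _)
      linarith
    obtain ⟨a, a', b, b', e1, e2, e3, e4, e5, e6⟩ := hacc h2τ e Φ V ρ₀ ρ₁ _ hV h₀ h₁ h1 hlE
      (isHermitian_chiHat (freq S j)) ((hclose j hj).mono h16)
    rw [abs_le] at e5 e6
    rw [estB, estE, e1, e2, e3, e4]
    -- All entropies are finite here. The shifts by `∓τ` in the estimators turn the two-sided error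
    -- `τ` into the one-sided intervals of length `2τ`.
    simp only [← EReal.coe_sub, ← EReal.coe_add, EReal.coe_le_coe_iff]
    exact ⟨by linarith [e5.1], by linarith [e5.2], by linarith [e6.1], by linarith [e6.2]⟩
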